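/- For $\lambda>0$ let $\mathcal H^{(\lambda)}$ be the reproducing kernel Hilbert space on the open unit disc $\mathbb D$ with kernel $K^{(\lambda)}(z,w)=(1-z\bar w)^{-\lambda}$, and let $M_z$ be multiplication by the coordinate function on it. Let $n\ge 1$, let $0<\lambda_0\le\lambda_1\le\dots\le\lambda_{n-1}$ be real numbers with $\lambda_{i+1}-\lambda_i=\Lambda$ for all $0\le i\le n-2$, and let $m_{i,j}$, $0\le i<j\le n-1$, be complex numbers. Let $T$ be a quasi-homogeneous operator with these data, that is, a bounded operator on $\mathcal H^{(\lambda_0)}\oplus\cdots\oplus\mathcal H^{(\lambda_{n-1})}$ whose block matrix is upper triangular, with diagonal entries $T_i=M_z^*$ on $\mathcal H^{(\lambda_i)}$ and with entries $S_{i,j}:\mathcal H^{(\lambda_j)}\to\mathcal H^{(\lambda_i)}$, $i<j$, satisfying $$S_{i,j}\bigl(K^{(\lambda_j)}(\cdot,w)\bigr)=m_{i,j}\,\bar\partial_w^{\,j-i-1}K^{(\lambda_i)}(\cdot,w),\qquad w\in\mathbb D.$$ Call an operator $A$ Möbius bounded if $\sigma(A)\subseteq\overline{\mathbb D}$ and $\sup_{\varphi}\|\varphi(A)\|<\infty$,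 where $\varphi$ runs over all biholomorphic automorphisms $\varphi(z)=e^{i\theta}\frac{z-a}{1-\bar a z}$ ($\theta\in\mathbb R$, $|a|<1$) of $\mathbb D$ and $\varphi(A)$ is given by the holomorphic functional calculus. Theorem. If $\Lambda\ge 2$, then $T$ is Möbius bounded. If $m_{i,i+1}\neq 0$ for at least one $i$ (in particular, if $n\ge2$ and all the entries $S_{i,i+1}$ are non-zero), then $T$ is Möbius bounded if and only if $\Lambda\ge 2$. -/

import Mathlib

open Complex ComplexConjugate

namespace QuasiHom

noncomputable section

/-- The expression `K^(l)(z, w) = (1 - z * conj w)^(-l)` (principal branch; for `z, w` in the open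
unit disc the base has positive real part). -/
def kerExpr (l : ℝ) (z w : ℂ) : ℂ := (1 - z * conj w) ^ (-(l : ℂ))

/-- The kernel `K^(l)` on the open unit disc, as a (scalar) operator-valued matrix. -/
def kerMatrix (l : ℝ) : Matrix UnitDisc UnitDisc (ℂ →L[ℂ] ℂ) :=
  .of fun z w => kerExpr l z w • (1 : ℂ →L[ℂ] ℂ)

/-- Binomial expansion of the kernel with nonnegative coefficients. -/
theorem kerExpr_hasSum (l : ℝ) (hl : 0 < l) :
    ∃ b : ℕ → ℝ, (∀ k, 0 ≤ b k) ∧ ∀ z w : UnitDisc,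
      HasSum (fun k => (b k : ℂ) * (((z : ℂ) * conj (w : ℂ)) ^ k)) (kerExpr l z w) := by
  refine ⟨fun k => Ring.choose (l + k - 1) k, ?_, ?_⟩
  · intro k
    have h := Ring.factorial_nsmul_multichoose_eq_ascPochhammer l k
    rw [Ring.multichoose_eq, Polynomial.ascPochhammer_smeval_eq_eval, nsmul_eq_mul] at h
    have hp := ascPochhammer_pos k l hl
    rw [← h] at hp
    exact (pos_of_mul_pos_right hp (by positivity)).le
  · intro z w
    have hlt : ‖(z : ℂ) * conj (w : ℂ)‖ < 1 := by
      rw [norm_mul, RCLike.norm_conj]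
      have h1 := z.norm_lt_one
      have h2 := w.norm_lt_one
      nlinarith [norm_nonneg (z : ℂ), norm_nonneg (w : ℂ)]
    have h := (Complex.one_div_one_sub_cpow_hasFPowerSeriesOnBall_zero (l : ℂ)).hasSum
      (y := (z : ℂ) * conj (w : ℂ)) (by
        rw [Metric.mem_eball, edist_zero_right, ← ofReal_norm, ← ENNReal.ofReal_one]
        exact (ENNReal.ofReal_lt_ofReal_iff one_pos).2 hlt)
    rw [zero_add, one_div] at h
    rw [kerExpr, Complex.cpow_neg]
    have e : (fun k : ℕ => ((Ring.choose (l + k - 1) k : ℝ) : ℂ) * ((z : ℂ) * conj (w : ℂ)) ^ k) =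
        fun k => (FormalMultilinearSeries.ofScalars ℂ
          (fun n : ℕ => Ring.choose ((l : ℂ) + n - 1) n) k) fun _ => (z : ℂ) * conj (w : ℂ) := by
      funext k
      simp [Complex.ofReal_choose, mul_comm]
    simpa only [e] using h

/-- `K^(l)` is a non-negative definite kernel for `l > 0`. -/
instance kerMatrix_posSemidef (l : {x : ℝ // 0 < x}) : Fact (kerMatrix l).PosSemidef := by
  obtain ⟨b, hb, hs⟩ := kerExpr_hasSum l l.2
  constructor
  refine ((RKHS.posSemidef_tfae (K := kerMatrix l)).out 0 2 rfl rfl).mpr ⟨?_, ?_⟩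
  · ext z w
    have h1 := (hs w z).map (starRingEnd ℂ) Complex.continuous_conj
    have h2 : kerExpr l z w = conj (kerExpr l w z) := by
      refine (hs z w).unique ?_
      convert h1 using 2 with k
      simp [mul_comm]
    simp [kerMatrix, h2]
  · intro v
    have key : HasSum (fun k => b k * ‖v.sum fun x c => conj ((x : ℂ) ^ k) * c‖ ^ 2)
        (RCLike.re (v.sum fun x c => v.sum fun x' c' =>
          inner ℂ (kerMatrix l x' x c) c')) := by
      have h := hasSum_sum (s := v.support) fun x _ => hasSum_sum (s := v.support) fun x' _ =>
        ((hs x x').mul_left (conj (v x) * v x'))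
      have h' := Complex.reCLM.hasSum h
      convert h' using 1
      · funext k
        simp only [Complex.reCLM_apply]
        rw [← Complex.ofReal_re (b k * _)]
        congr 1
        push_cast
        rw [← Complex.mul_conj', Finsupp.sum, map_sum, Finset.sum_mul_sum, Finset.mul_sum,
          Finset.sum_comm]
        refine Finset.sum_congr rfl fun x _ => ?_
        rw [Finset.mul_sum]
        refine Finset.sum_congr rfl fun x' _ => ?_
        simp [mul_pow]
        ring
      · simp only [Finsupp.sum, Complex.reCLM_apply, RCLike.re_eq_complex_re]
        refine congrArg Complex.re ?_
        refine Finset.sum_congr rfl fun x _ => Finset.sum_congr rfl fun x' _ => ?_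
        have h2 : conj (kerExpr l x' x) = kerExpr l x x' := by
          refine HasSum.unique ((hs x' x).map (starRingEnd ℂ) Complex.continuous_conj) ?_
          convert hs x x' using 2 with k
          simp [mul_comm]
        simp [kerMatrix, h2]
        ring
    exact key.nonneg fun k => mul_nonneg (hb k) (by positivity)

/-- The space `H^(l)`: the reproducing kernel Hilbert space on the unit disc with kernel
`(1 - z * conj w)^(-l)`. -/
abbrev HSpace (l : {x : ℝ // 0 < x}) : Type := RKHS.OfKernel (kerMatrix l)

/-- The Hilbert space direct sum of the `H^(lam i)`. -/
abbrev HSum {n : ℕ} (lam : Fin n → {x : ℝ // 0 < x}) : Type := PiLp 2 fun i => HSpace (lam i)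

/-- The `(i, j)` entry of the block matrix of an operator on the direct sum. -/
def block {n : ℕ} {lam : Fin n → {x : ℝ // 0 < x}} (T : HSum lam →L[ℂ] HSum lam) (i j : Fin n) :
    HSpace (lam j) →L[ℂ] HSpace (lam i) :=
  (PiLp.proj 2 (fun i => HSpace (lam i)) i : HSum lam →L[ℂ] HSpace (lam i)) ∘L T ∘L
    ((PiLp.continuousLinearEquiv 2 ℂ fun i => HSpace (lam i)).symm :
      (∀ i, HSpace (lam i)) →L[ℂ] HSum lam) ∘L
    ContinuousLinearMap.single ℂ (fun i => HSpace (lam i)) j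

/-- The Wirtinger derivative `∂f/∂(conj w) = (∂f/∂x + i ∂f/∂y) / 2`. -/
def dbar (f : ℂ → ℂ) (w : ℂ) : ℂ := (1 / 2) * (fderiv ℝ f w 1 + I * fderiv ℝ f w I)

/-- `A` is the adjoint of the operator of multiplication by the coordinate function `z`. -/
def IsAdjointMulZ {l : {x : ℝ // 0 < x}} (A : HSpace l →L[ℂ] HSpace l) : Prop :=
  ∀ (f : HSpace l) (z : UnitDisc), (ContinuousLinearMap.adjoint A f) z = (z : ℂ) * f z

/-- The operator `T` on `H^(lam 0) ⊕ ⋯ ⊕ H^(lam (n-1))` is upper triangular, with the operators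
`M_z^*` on the diagonal, and with entries `S i j` above it that satisfy
`S i j (K^(lam j)(·, w)) = m i j • ∂bar_w^(j - i - 1) K^(lam i)(·, w)` for all `w` in the disc. -/
structure IsQuasiHomogeneous {n : ℕ} (lam : Fin n → {x : ℝ // 0 < x}) (m : Fin n → Fin n → ℂ)
    (T : HSum lam →L[ℂ] HSum lam) : Prop where
  diag : ∀ i, IsAdjointMulZ (block T i i)
  upper : ∀ i j : Fin n, i < j → ∀ w z : UnitDisc,
    (block T i j (RKHS.kerFun (HSpace (lam j)) w 1)) z =
      m i j * (dbar^[(j : ℕ) - (i : ℕ) - 1] fun u => kerExpr (lam i) z u) w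
  lower : ∀ i j : Fin n, j < i → block T i j = 0

/-- The Möbius map `e^(iθ) (z - a) / (1 - conj a * z)`. -/
def mobius (θ : ℝ) (a : UnitDisc) (z : ℂ) : ℂ :=
  exp (θ * I) * ((z - a) / (1 - conj (a : ℂ) * z))

/-- The holomorphic functional calculus: `(2πi)⁻¹ ∮ f(z) (z - T)⁻¹ dz` over the circle of radius `r`
about the origin. It is `f(T)` as soon as the spectrum of `T` lies inside the circle and `f` is
holomorphic in a neighbourhood of the closed disc of radius `r`. -/
def holCalc {E : Type*} [NormedAddCommGroup E] [NormedSpace ℂ E] [CompleteSpace E] (f : ℂ → ℂ) (T : E →L[ℂ] E)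
    (r : ℝ) : E →L[ℂ] E :=
  (2 * Real.pi * I : ℂ)⁻¹ • ∮ z in C(0, r), f z • resolvent T z

/-- `T` is Möbius bounded: its spectrum lies in the closed unit disc, and the norms `‖φ(T)‖` are
bounded uniformly over all biholomorphic automorphisms `φ` of the disc. The contour for `φ(T)` is
any circle with `1 < r < 1 / |a|` (any `r > 1` when `a = 0`), so that it encloses the spectrum and
`φ` is holomorphic on the closed disc that it bounds; the value does not depend on `r`. -/
def MobiusBounded {E : Type*} [NormedAddCommGroup E] [NormedSpace ℂ E] [CompleteSpace E] (T : E →L[ℂ] E) : Prop :=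
  spectrum ℂ T ⊆ Metric.closedBall 0 1 ∧
    ∃ C : ℝ, ∀ (θ : ℝ) (a : UnitDisc) (r : ℝ), 1 < r → r * ‖(a : ℂ)‖ < 1 →
      ‖holCalc (mobius θ a) T r‖ ≤ C

end

end QuasiHom

namespace QuasiHom

open Metric

noncomputable section

/-! ### Power series on the unit disc -/

/-! The argument runs on the adjoint, which acts on tuples of holomorphic functions: `(T* F)_j = z
F_j + ∑_{i<j} conj (m i j) F_i^(j-i-1)` (`IsQuasiHomogeneous.adjoint_apply`). Inverting `ζ - T*` is
forward substitution in a triangular system, so its entries are sums of terms `c_{i,l} (ζ -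
z)^(-l-1) f_i^(j-i-l)` with constants depending only on `m` (`exists_resolvent_coeff`). Cauchy's
formula then turns `φ(T)*` into the operator with entries `∑_l (c_{i,l} / l!) ψ^(l) f_i^(j-i-l)`,
where `ψ(w) = conj (φ (conj w))` is again a Möbius map. Off the diagonal `c_{i,0} = 0`, so at least
one derivative falls on `ψ`.

Sufficiency: differentiation is bounded from `H^(l)` to `H^(l+2)`, and multiplication by `ψ'` is a
contraction between the same spaces, because weighted composition with `ψ` intertwines it with the
inclusion `H^(l) ⊆ H^(l+2)`. By the Leibniz rule multiplication by `ψ^(k)` maps `H^(l)` to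
`H^(l+2k)` with a bound independent of `ψ`. The `(i, j)` entry therefore lands in `H^(λ_i +
2(j-i))`, which lies in `H^(λ_j)` when `Λ ≥ 2`. The diagonal entry is multiplication by `ψ`, of norm
at most `‖M_z‖`.

Necessity: for `j = i + 1` the entry is multiplication by `conj (m i j) ψ'`. Testing it on the
kernel function at `a`, with `ψ` vanishing at `a`, gives `|m i j| ≤ C (1 - |a|²)^(1 - Λ/2)`, and
`|a| → 1` forces `Λ ≥ 2`. -/

theorem differentiableOn_and_hasSum_deriv_of_hasSum {c : ℕ → ℂ} {F : ℂ → ℂ}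
    (h : ∀ z, ‖z‖ < 1 → HasSum (fun k => c k * z ^ k) (F z)) :
    DifferentiableOn ℂ F (ball 0 1) ∧
      ∀ z, ‖z‖ < 1 → HasSum (fun k : ℕ => (k + 1) * c (k + 1) * z ^ k) (deriv F z) := by
  have key : ∀ z, ‖z‖ < 1 → DifferentiableAt ℂ F z ∧
      HasSum (fun k : ℕ => (k + 1) * c (k + 1) * z ^ k) (deriv F z) := by
    intro z hz
    obtain ⟨ρ, hzρ, hρ⟩ := exists_between hz
    have hρ0 : 0 ≤ ρ := (norm_nonneg z).trans hzρ.le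
    have hsum : Summable fun k => ‖c k‖ * ρ ^ k := by
      have := (h (ρ : ℂ) (by simpa [abs_of_nonneg hρ0] using hρ)).summable.norm
      simpa [abs_of_nonneg hρ0] using this
    have hd : ∀ k : ℕ, DifferentiableOn ℂ (fun w : ℂ => c k * w ^ k) (ball 0 ρ) :=
      fun k => by fun_prop
    have hle : ∀ (k : ℕ) (w : ℂ), w ∈ ball (0 : ℂ) ρ → ‖c k * w ^ k‖ ≤ ‖c k‖ * ρ ^ k := by
      intro k w hw
      rw [norm_mul, norm_pow]
      have : ‖w‖ ≤ ρ := by simpa using (mem_ball_zero_iff.1 hw).le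
      gcongr
    have hzm : z ∈ ball (0 : ℂ) ρ := mem_ball_zero_iff.2 hzρ
    have heq : F =ᶠ[nhds z] fun w => ∑' k, c k * w ^ k := by
      filter_upwards [isOpen_ball.mem_nhds hzm] with w hw
      exact (h w ((mem_ball_zero_iff.1 hw).trans hρ)).tsum_eq.symm
    have h1 := (differentiableOn_tsum_of_summable_norm hsum hd isOpen_ball hle).differentiableAt
      (isOpen_ball.mem_nhds hzm)
    have h2 := hasSum_deriv_of_summable_norm hsum hd isOpen_ball hle hzm
    refine ⟨h1.congr_of_eventuallyEq heq, ?_⟩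
    rw [heq.deriv_eq]
    have h3 := (hasSum_nat_add_iff' 1).2 h2
    rw [Finset.sum_range_one, show deriv (fun w : ℂ => c 0 * w ^ 0) z = 0 by simp, sub_zero] at h3
    refine h3.congr_fun fun k => ?_
    simp
    ring
  exact ⟨fun z hz => (key z (mem_ball_zero_iff.1 hz)).1.differentiableWithinAt,
    fun z hz => (key z hz).2⟩

/-! ### Kernel functions -/

/-- The kernel function `K^(l)(·, w)`. -/
def kvec (l : {x : ℝ // 0 < x}) (w : UnitDisc) : HSpace l := RKHS.kerFun (HSpace l) w 1

theorem kvec_apply (l : {x : ℝ // 0 < x}) (w z : UnitDisc) : kvec l w z = kerExpr l z w := by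
  rw [kvec, RKHS.kerFun_apply, RKHS.OfKernel.kernel_ofKernel]
  simp [kerMatrix]

theorem inner_kvec_left {l : {x : ℝ // 0 < x}} (w : UnitDisc) (f : HSpace l) :
    inner ℂ (kvec l w) f = f w := by
  simp [kvec]

theorem inner_kvec_right {l : {x : ℝ // 0 < x}} (w : UnitDisc) (f : HSpace l) :
    inner ℂ f (kvec l w) = conj (f w) := by
  rw [← inner_conj_symm, inner_kvec_left]

theorem denseRange_linearCombination_kvec (l : {x : ℝ // 0 < x}) :
    DenseRange (Finsupp.linearCombination ℂ (kvec l)) := by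
  have h := RKHS.kerFun_dense (HSpace l)
  have h2 : Submodule.span ℂ {RKHS.kerFun (HSpace l) x v | (x) (v)} ≤
      LinearMap.range (Finsupp.linearCombination ℂ (kvec l)) := by
    rw [Submodule.span_le]
    rintro _ ⟨x, v, rfl⟩
    refine ⟨Finsupp.single x v, ?_⟩
    rw [Finsupp.linearCombination_single, kvec, ← map_smul, smul_eq_mul, mul_one]
  rw [DenseRange, ← LinearMap.coe_range]
  exact (Submodule.dense_iff_topologicalClosure_eq_top.2 h).mono h2

/-- Two continuous linear functionals agreeing on the kernel functions are equal. -/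
theorem eq_of_eq_on_kvec {l : {x : ℝ // 0 < x}} {G : Type*} [NormedAddCommGroup G]
    [NormedSpace ℂ G] {A B : HSpace l →L[ℂ] G} (h : ∀ w, A (kvec l w) = B (kvec l w)) : A = B := by
  refine ContinuousLinearMap.ext fun x => ?_
  refine congrFun ((denseRange_linearCombination_kvec l).equalizer A.continuous B.continuous
    (funext fun v => ?_)) x
  simp [Finsupp.linearCombination_apply, Finsupp.sum, map_sum, h]

/-- A family of vectors with Gram matrix `K^(l)` induces an isometry from `H^(l)`. -/
theorem exists_linearIsometry {l : {x : ℝ // 0 < x}} {G : Type*} [NormedAddCommGroup G]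
    [InnerProductSpace ℂ G] [CompleteSpace G] {u : UnitDisc → G}
    (hu : ∀ z w, inner ℂ (u z) (u w) = kerExpr l z w) :
    ∃ J : HSpace l →ₗᵢ[ℂ] G, ∀ w, J (kvec l w) = u w := by
  have hd := denseRange_linearCombination_kvec l
  have hn : ∀ c : UnitDisc →₀ ℂ, ‖Finsupp.linearCombination ℂ u c‖ =
      ‖Finsupp.linearCombination ℂ (kvec l) c‖ := by
    intro c
    rw [@norm_eq_sqrt_re_inner ℂ, @norm_eq_sqrt_re_inner ℂ]
    congr 2
    simp only [Finsupp.linearCombination_apply, Finsupp.sum, sum_inner, inner_sum, inner_smul_left,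
      inner_smul_right, hu, inner_kvec_left, kvec_apply]
  have hb : ∃ C, ∀ c, ‖Finsupp.linearCombination ℂ u c‖ ≤
      C * ‖Finsupp.linearCombination ℂ (kvec l) c‖ := ⟨1, fun c => by rw [hn, one_mul]⟩
  let J := (Finsupp.linearCombination ℂ u).extendOfNorm (Finsupp.linearCombination ℂ (kvec l))
  have hJ : ∀ c, J (Finsupp.linearCombination ℂ (kvec l) c) = Finsupp.linearCombination ℂ u c :=
    LinearMap.extendOfNorm_eq hd hb
  refine ⟨⟨J.toLinearMap, fun x => ?_⟩, fun w => ?_⟩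
  · refine congrFun (DenseRange.equalizer hd (g := fun x => ‖J x‖) (h := fun x => ‖x‖)
      J.continuous.norm continuous_norm (funext fun c => ?_)) x
    simp only [Function.comp_apply, hJ, hn]
  · have := hJ (Finsupp.single w 1)
    simpa using this

/-! ### Coefficients -/

/-- The coefficients of the binomial series `(1 - x)^(-l)`. -/
def kcoef (l : ℝ) : ℕ → ℝ := fun k => ∏ i ∈ Finset.range k, (l + i) / (i + 1)

theorem kcoef_succ (l : ℝ) (k : ℕ) : kcoef l (k + 1) = kcoef l k * ((l + k) / (k + 1)) := by
  rw [kcoef, Finset.prod_range_succ]; rfl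

theorem kcoef_pos {l : ℝ} (hl : 0 < l) (k : ℕ) : 0 < kcoef l k :=
  Finset.prod_pos fun i _ => by positivity

theorem kcoef_mono {l l' : ℝ} (hl : 0 < l) (h : l ≤ l') (k : ℕ) : kcoef l k ≤ kcoef l' k := by
  unfold kcoef; gcongr

/-- This relation compares the norms of `z^(k+1)` in `H^(l)` and of `z^k` in `H^(l+2)`; it is what
makes differentiation bounded between these spaces. -/
theorem kcoef_add_two (l : ℝ) (k : ℕ) :
    l * (l + 1) * kcoef (l + 2) k = (k + 1) * (l + k + 1) * kcoef l (k + 1) := by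
  induction k with
  | zero => simp [kcoef]; ring
  | succ k ih =>
    rw [kcoef_succ, kcoef_succ l (k + 1), ← mul_assoc, ih]
    push_cast
    field_simp
    ring

theorem kcoef_eq_choose (l : ℝ) (k : ℕ) : kcoef l k = Ring.choose (l + k - 1) k := by
  have h := Ring.factorial_nsmul_multichoose_eq_ascPochhammer l k
  rw [Ring.multichoose_eq, Polynomial.ascPochhammer_smeval_eq_eval, nsmul_eq_mul] at h
  have hk : (k.factorial : ℝ) ≠ 0 := by positivity
  have h2 : (ascPochhammer ℝ k).eval l = k.factorial * kcoef l k := by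
    clear h hk
    induction k with
    | zero => simp [kcoef]
    | succ k ih =>
      rw [ascPochhammer_succ_eval, ih, kcoef_succ, Nat.factorial_succ]
      push_cast
      field_simp
  exact (mul_left_cancel₀ hk (h.trans h2)).symm

theorem hasSum_kcoef (l : ℝ) {x : ℂ} (hx : ‖x‖ < 1) :
    HasSum (fun k => (kcoef l k : ℂ) * x ^ k) ((1 - x) ^ (-(l : ℂ))) := by
  have h := (Complex.one_div_one_sub_cpow_hasFPowerSeriesOnBall_zero (l : ℂ)).hasSum
    (y := x) (by
      rw [mem_eball, edist_zero_right, ← ofReal_norm, ← ENNReal.ofReal_one]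
      exact (ENNReal.ofReal_lt_ofReal_iff one_pos).2 hx)
  rw [zero_add, one_div] at h
  rw [Complex.cpow_neg]
  have e : (fun k : ℕ => (kcoef l k : ℂ) * x ^ k) =
      fun k => (FormalMultilinearSeries.ofScalars ℂ
        (fun n : ℕ => Ring.choose ((l : ℂ) + n - 1) n) k) fun _ => x := by
    funext k
    simp [kcoef_eq_choose, Complex.ofReal_choose, mul_comm]
  simpa only [e] using h

theorem norm_mul_conj_lt_one (z w : UnitDisc) : ‖(z : ℂ) * conj (w : ℂ)‖ < 1 := by
  rw [norm_mul, RCLike.norm_conj]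
  nlinarith [norm_nonneg (z : ℂ), norm_nonneg (w : ℂ), z.norm_lt_one, w.norm_lt_one]

theorem exists_coeffVec (l : {x : ℝ // 0 < x}) (w : UnitDisc) :
    ∃ u : lp (fun _ : ℕ => ℂ) 2, ∀ k, u k = √(kcoef l k) * conj (w : ℂ) ^ k := by
  refine ⟨⟨fun k => √(kcoef l k) * conj (w : ℂ) ^ k,
    (memℓp_gen_iff (p := 2) (by norm_num)).2 ?_⟩, fun k => rfl⟩
  have h := (hasSum_kcoef l (norm_mul_conj_lt_one w w)).summable.norm
  convert h using 2 with k
  have := (kcoef_pos l.2 k).le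
  simp only [norm_mul, norm_pow, RCLike.norm_conj, ENNReal.toReal_ofNat, Real.rpow_ofNat,
    Complex.norm_real, Real.norm_eq_abs, abs_of_nonneg (Real.sqrt_nonneg _), abs_of_nonneg this]
  rw [mul_pow, Real.sq_sqrt this]
  ring

/-- The vector in `ℓ²` representing the kernel function at `w`. -/
def coeffVec (l : {x : ℝ // 0 < x}) (w : UnitDisc) : lp (fun _ : ℕ => ℂ) 2 :=
  (exists_coeffVec l w).choose

theorem coeffVec_apply (l : {x : ℝ // 0 < x}) (w : UnitDisc) (k : ℕ) :
    coeffVec l w k = √(kcoef l k) * conj (w : ℂ) ^ k := (exists_coeffVec l w).choose_spec k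

theorem hasSum_inner_coeffVec (l : {x : ℝ // 0 < x}) (w : UnitDisc) (x : lp (fun _ : ℕ => ℂ) 2) :
    HasSum (fun k => √(kcoef l k) * x k * (w : ℂ) ^ k) (inner ℂ (coeffVec l w) x) := by
  refine (lp.hasSum_inner (𝕜 := ℂ) (coeffVec l w) x).congr_fun fun k => ?_
  simp [coeffVec_apply]
  ring

theorem inner_coeffVec (l : {x : ℝ // 0 < x}) (z w : UnitDisc) :
    inner ℂ (coeffVec l z) (coeffVec l w) = kerExpr l z w := by
  refine (hasSum_inner_coeffVec l z _).unique ?_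
  refine (hasSum_kcoef l (norm_mul_conj_lt_one z w)).congr_fun fun k => ?_
  rw [coeffVec_apply, mul_pow, ← mul_assoc, ← ofReal_mul, Real.mul_self_sqrt (kcoef_pos l.2 k).le]
  ring

/-! ### Norm-controlled membership in `H^(l)`: linear operations, inclusion, differentiation. -/

/-- `F` restricts on the disc to an element of `H^(l)` of norm at most `C`. -/
def InH (l : {x : ℝ // 0 < x}) (F : ℂ → ℂ) (C : ℝ) : Prop :=
  ∃ g : HSpace l, (∀ z : UnitDisc, g z = F z) ∧ ‖g‖ ≤ C

/-- The functions `√(kcoef l k) z^k` serve as an orthonormal basis. The isometry `J` into `ℓ²` sends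
kernel functions to `coeffVec`; `J` gives one direction and its contractive adjoint the other, so
surjectivity of `J` is never needed. -/
theorem inH_iff_coeff {l : {x : ℝ // 0 < x}} {F : ℂ → ℂ} {C : ℝ} :
    InH l F C ↔ ∃ x : lp (fun _ : ℕ => ℂ) 2, ‖x‖ ≤ C ∧
      ∀ w : ℂ, ‖w‖ < 1 → HasSum (fun k => √(kcoef l k) * x k * w ^ k) (F w) := by
  obtain ⟨J, hJ⟩ := exists_linearIsometry (inner_coeffVec l)
  constructor
  · rintro ⟨g, hg, hC⟩
    refine ⟨J g, by rwa [J.norm_map], fun w hw => ?_⟩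
    have h := hasSum_inner_coeffVec l (UnitDisc.mk w hw) (J g)
    rw [← hJ, J.inner_map_map, inner_kvec_left, hg] at h
    simpa using h
  · rintro ⟨x, hx, hF⟩
    refine ⟨ContinuousLinearMap.adjoint J.toContinuousLinearMap x, fun w => ?_, ?_⟩
    · rw [← inner_kvec_left, ContinuousLinearMap.adjoint_inner_right]
      refine HasSum.unique ?_ (hF w w.norm_lt_one)
      rw [LinearIsometry.coe_toContinuousLinearMap, hJ]
      exact hasSum_inner_coeffVec l w x
    · refine (ContinuousLinearMap.le_opNorm _ _).trans ?_
      rw [LinearIsometryEquiv.norm_map]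
      exact (mul_le_of_le_one_left (norm_nonneg _) J.norm_toContinuousLinearMap_le).trans hx

theorem InH.differentiableOn {l : {x : ℝ // 0 < x}} {F : ℂ → ℂ} {C : ℝ} (h : InH l F C) :
    DifferentiableOn ℂ F (ball 0 1) := by
  obtain ⟨x, -, hx⟩ := inH_iff_coeff.1 h
  exact (differentiableOn_and_hasSum_deriv_of_hasSum hx).1

theorem InH.congr {l : {x : ℝ // 0 < x}} {F G : ℂ → ℂ} {C : ℝ} (h : InH l F C)
    (hFG : ∀ z, ‖z‖ < 1 → F z = G z) : InH l G C := by
  obtain ⟨g, hg, hC⟩ := h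
  exact ⟨g, fun z => (hg z).trans (hFG z z.norm_lt_one), hC⟩

theorem InH.zero (l : {x : ℝ // 0 < x}) : InH l (fun _ => 0) 0 := ⟨0, by simp, by simp⟩

theorem InH.add {l : {x : ℝ // 0 < x}} {F G : ℂ → ℂ} {C C' : ℝ} (h : InH l F C) (h' : InH l G C') :
    InH l (fun z => F z + G z) (C + C') := by
  obtain ⟨f, hf, hC⟩ := h
  obtain ⟨g, hg, hC'⟩ := h'
  exact ⟨f + g, by simp [hf, hg], (norm_add_le _ _).trans (add_le_add hC hC')⟩

theorem InH.const_mul {l : {x : ℝ // 0 < x}} {F : ℂ → ℂ} {C : ℝ} (c : ℂ) (h : InH l F C) :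
    InH l (fun z => c * F z) (‖c‖ * C) := by
  obtain ⟨f, hf, hC⟩ := h
  exact ⟨c • f, by simp [hf], by rw [norm_smul]; gcongr⟩

theorem InH.sub {l : {x : ℝ // 0 < x}} {F G : ℂ → ℂ} {C C' : ℝ} (h : InH l F C) (h' : InH l G C') :
    InH l (fun z => F z - G z) (C + C') := by
  obtain ⟨f, hf, hC⟩ := h
  obtain ⟨g, hg, hC'⟩ := h'
  exact ⟨f - g, by simp [hf, hg], (norm_sub_le _ _).trans (add_le_add hC hC')⟩

theorem InH.sum {l : {x : ℝ // 0 < x}} {ι : Type*} (s : Finset ι) {F : ι → ℂ → ℂ} {C : ι → ℝ}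
    (h : ∀ i ∈ s, InH l (F i) (C i)) : InH l (fun z => ∑ i ∈ s, F i z) (∑ i ∈ s, C i) := by
  classical
  induction s using Finset.induction_on with
  | empty => simpa using InH.zero l
  | insert a s ha ih =>
    simp only [Finset.sum_insert ha]
    exact (h a (Finset.mem_insert_self a s)).add
      (ih fun i hi => h i (Finset.mem_insert_of_mem hi))

/-- Comparison of coefficient sequences in `ℓ²`. -/
theorem exists_lp_of_norm_le {x : lp (fun _ : ℕ => ℂ) 2} {y : ℕ → ℂ} {s : ℕ → ℕ}
    (hs : Function.Injective s) {C : ℝ} (hC : 0 ≤ C) (h : ∀ k, ‖y k‖ ≤ C * ‖x (s k)‖) :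
    ∃ y' : lp (fun _ : ℕ => ℂ) 2, (∀ k, y' k = y k) ∧ ‖y'‖ ≤ C * ‖x‖ := by
  have hx : Summable fun k => ‖x k‖ ^ 2 := by
    have := (memℓp_gen_iff (p := 2) (by norm_num)).1 (lp.memℓp x)
    simpa using this
  have hle : ∀ k, ‖y k‖ ^ 2 ≤ C ^ 2 * ‖x (s k)‖ ^ 2 := fun k => by
    rw [← mul_pow]; exact pow_le_pow_left₀ (norm_nonneg _) (h k) 2
  have hxs : Summable fun k => C ^ 2 * ‖x (s k)‖ ^ 2 := (hx.comp_injective hs).mul_left _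
  have hy : Summable fun k => ‖y k‖ ^ 2 := hxs.of_nonneg_of_le (fun _ => by positivity) hle
  refine ⟨⟨y, (memℓp_gen_iff (p := 2) (by norm_num)).2 (by simpa using hy)⟩, fun k => rfl, ?_⟩
  refine lp.norm_le_of_tsum_le (by norm_num) (by positivity) ?_
  simp only [ENNReal.toReal_ofNat, Real.rpow_ofNat]
  have hn := lp.norm_rpow_eq_tsum (p := 2) (by norm_num) x
  simp only [ENNReal.toReal_ofNat, Real.rpow_ofNat] at hn
  rw [mul_pow, hn, ← tsum_mul_left]
  calc _ ≤ ∑' k, C ^ 2 * ‖x (s k)‖ ^ 2 := hy.tsum_le_tsum hle hxs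
    _ ≤ _ := tsum_comp_le_tsum_of_inj (hx.mul_left _) (fun _ => by positivity) hs

theorem InH.inclusion {l l' : {x : ℝ // 0 < x}} (hl : (l : ℝ) ≤ l') {F : ℂ → ℂ} {C : ℝ}
    (h : InH l F C) : InH l' F C := by
  obtain ⟨x, hx, hF⟩ := inH_iff_coeff.1 h
  obtain ⟨y, hy, hyn⟩ := exists_lp_of_norm_le (x := x) (s := id)
    (y := fun k => (√(kcoef l k) / √(kcoef l' k) : ℝ) * x k) Function.injective_id zero_le_one (by
      intro k
      rw [norm_mul, Complex.norm_real, Real.norm_of_nonneg (by positivity)]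
      have := Real.sqrt_le_sqrt (kcoef_mono l.2 hl k)
      exact mul_le_mul_of_nonneg_right (div_le_one_of_le₀ this (Real.sqrt_nonneg _))
        (norm_nonneg _))
  refine inH_iff_coeff.2 ⟨y, by linarith, fun w hw => ?_⟩
  convert hF w hw using 3 with k
  have : (√(kcoef l' k) : ℂ) ≠ 0 := ofReal_ne_zero.2 (Real.sqrt_pos.2 (kcoef_pos l'.2 k)).ne'
  rw [hy, ofReal_div]
  field_simp

/-- In the orthonormal coordinates differentiation is a weighted shift with squared weights `(k+1)²
kcoef l (k+1) / kcoef (l+2) k = l (l+1) (k+1) / (l+k+1)`, which are at most `l (l+1)`. -/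
theorem InH.deriv_inH {l l' : {x : ℝ // 0 < x}} (hl : (l' : ℝ) = l + 2) {F : ℂ → ℂ} {C : ℝ}
    (h : InH l F C) : InH l' (deriv F) (√(l * (l + 1)) * C) := by
  obtain ⟨x, hx, hF⟩ := inH_iff_coeff.1 h
  obtain ⟨y, hy, hyn⟩ := exists_lp_of_norm_le (x := x) (s := Nat.succ) (C := √(l * (l + 1)))
    (y := fun k => ((k + 1) * (√(kcoef l (k + 1)) / √(kcoef l' k)) : ℝ) * x (k + 1))
    Nat.succ_injective (Real.sqrt_nonneg _) (by
      intro k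
      rw [norm_mul, Complex.norm_real, Real.norm_of_nonneg (by positivity)]
      gcongr
      have h1 := kcoef_pos l'.2 k
      have h0 := l.2
      apply Real.le_sqrt_of_sq_le
      rw [mul_pow, div_pow, Real.sq_sqrt (kcoef_pos l.2 _).le, Real.sq_sqrt h1.le]
      have h2 := kcoef_add_two (l : ℝ) k
      have h3 := kcoef_pos h0 (k + 1)
      rw [← hl] at h2
      rw [← mul_div_assoc, div_le_iff₀ h1, h2]
      have : (0 : ℝ) ≤ (k + 1) * l * kcoef l (k + 1) := by positivity
      nlinarith)
  refine inH_iff_coeff.2 ⟨y, hyn.trans (by gcongr), fun w hw => ?_⟩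
  convert (differentiableOn_and_hasSum_deriv_of_hasSum hF).2 w hw using 3 with k
  have : (√(kcoef l' k) : ℂ) ≠ 0 := ofReal_ne_zero.2 (Real.sqrt_pos.2 (kcoef_pos l'.2 k)).ne'
  rw [hy]
  push_cast
  field_simp

/-! ### Möbius transformations -/

theorem re_pos_one_sub {x : ℂ} (hx : ‖x‖ < 1) : 0 < (1 - x).re := by
  have := (re_le_norm x).trans_lt hx
  simpa using this

theorem ne_zero_of_re_pos {x : ℂ} (hx : 0 < x.re) : x ≠ 0 := by
  rintro rfl
  simp at hx

theorem norm_conj_mul_lt_one (a : UnitDisc) {z : ℂ} (hz : ‖z‖ < 1) : ‖conj (a : ℂ) * z‖ < 1 := by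
  rw [norm_mul, RCLike.norm_conj]
  nlinarith [norm_nonneg (a : ℂ), norm_nonneg z, a.norm_lt_one]

theorem one_sub_conj_mul_ne_zero (a : UnitDisc) {z : ℂ} (hz : ‖z‖ < 1) :
    1 - conj (a : ℂ) * z ≠ 0 := ne_zero_of_re_pos (re_pos_one_sub (norm_conj_mul_lt_one a hz))

theorem one_sub_norm_sq_pos (a : UnitDisc) : 0 < 1 - ‖(a : ℂ)‖ ^ 2 := by
  have := a.sq_norm_lt_one
  linarith

/-- The Möbius map `(z - a) / (1 - conj a * z)`. -/
def mobius0 (a : UnitDisc) (z : ℂ) : ℂ := (z - a) / (1 - conj (a : ℂ) * z)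

/-- With `z = w` this identity shows that the disc is mapped into itself; raised to the power `-l`
it is the transformation rule of the kernel. -/
theorem one_sub_mobius0_mul_conj (a z w : UnitDisc) :
    (1 - mobius0 a z * conj (mobius0 a w)) * (1 - conj (a : ℂ) * z) * (1 - a * conj (w : ℂ)) =
      ((1 - ‖(a : ℂ)‖ ^ 2 : ℝ) : ℂ) * (1 - z * conj (w : ℂ)) := by
  have h1 := one_sub_conj_mul_ne_zero a z.norm_lt_one
  have h2 : 1 - a * conj (w : ℂ) ≠ 0 := by
    have := (map_ne_zero (starRingEnd ℂ)).2 (one_sub_conj_mul_ne_zero a w.norm_lt_one)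
    simpa using this
  have h3 : ((1 - ‖(a : ℂ)‖ ^ 2 : ℝ) : ℂ) = 1 - a * conj (a : ℂ) := by
    rw [mul_conj']; push_cast; ring
  rw [h3]
  simp only [mobius0, map_div₀, map_sub, map_mul, map_one, conj_conj]
  generalize conj (a : ℂ) = b at *
  rw [mul_comm b] at *
  field_simp
  ring

theorem norm_mobius0_lt_one (a z : UnitDisc) : ‖mobius0 a z‖ < 1 := by
  have h := one_sub_mobius0_mul_conj a z z
  have h1 := one_sub_conj_mul_ne_zero a z.norm_lt_one
  have e : (1 - conj (a : ℂ) * z) * (1 - a * conj (z : ℂ)) =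
      ((‖1 - conj (a : ℂ) * z‖ ^ 2 : ℝ) : ℂ) := by
    push_cast; rw [← mul_conj']; simp
  rw [mul_assoc, e, mul_conj', mul_conj'] at h
  norm_cast at h
  have h2 : 0 < ‖1 - conj (a : ℂ) * z‖ ^ 2 := by positivity
  have h3 := mul_pos (one_sub_norm_sq_pos a) (one_sub_norm_sq_pos z)
  rw [← h] at h3
  have := pos_of_mul_pos_left h3 h2.le
  nlinarith [norm_nonneg (mobius0 a z)]

/-- The Möbius map `mobius0 a` as a self-map of the disc. -/
def mobiusDisc (a z : UnitDisc) : UnitDisc := UnitDisc.mk (mobius0 a z) (norm_mobius0_lt_one a z)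

/-- Principal powers need not be multiplicative, but here the logarithms of the two sides differ by
`2πi n`, and four arguments of modulus below `π/2` leave only `n = 0`. -/
theorem cpow_mul_cpow_mul_cpow {x q r p : ℂ} {c : ℝ} (hc : 0 < c) (hx : 0 < x.re) (hq : 0 < q.re)
    (hr : 0 < r.re) (hp : 0 < p.re) (h : x * q * r = c * p) (s : ℂ) :
    x ^ s * q ^ s * r ^ s = (c : ℂ) ^ s * p ^ s := by
  have hlog : log x + log q + log r = log c + log p := by
    have he : exp (log x + log q + log r) = exp (log c + log p) := by
      simp only [exp_add]
      rw [exp_log (ne_zero_of_re_pos hx), exp_log (ne_zero_of_re_pos hq),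
        exp_log (ne_zero_of_re_pos hr), exp_log (ne_zero_of_re_pos hp),
        exp_log (ofReal_ne_zero.2 hc.ne'), h]
    obtain ⟨n, hn⟩ := Complex.exp_eq_exp_iff_exists_int.1 he
    have him := congrArg Complex.im hn
    have hb : ∀ y : ℂ, 0 < y.re → |y.arg| < Real.pi / 2 := fun y hy =>
      Complex.abs_arg_lt_pi_div_two_iff.2 (Or.inl hy)
    have h1 := abs_lt.1 (hb x hx)
    have h2 := abs_lt.1 (hb q hq)
    have h3 := abs_lt.1 (hb r hr)
    have h4 := abs_lt.1 (hb p hp)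
    simp only [add_im, log_im, arg_ofReal_of_nonneg hc.le, mul_im, intCast_re, intCast_im, I_re,
      I_im, mul_re, ofReal_re, ofReal_im, re_ofNat, im_ofNat] at him
    have hn0 : n = 0 := by
      have hpi := Real.pi_pos
      have u1 : (n : ℝ) < 1 := by nlinarith
      have u2 : (-1 : ℝ) < n := by nlinarith
      have u3 : n < 1 := by exact_mod_cast u1
      have u4 : -1 < n := by exact_mod_cast u2
      omega
    rw [hn, hn0]
    simp
  rw [cpow_def_of_ne_zero (ne_zero_of_re_pos hx), cpow_def_of_ne_zero (ne_zero_of_re_pos hq),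
    cpow_def_of_ne_zero (ne_zero_of_re_pos hr), cpow_def_of_ne_zero (ne_zero_of_re_pos hp),
    cpow_def_of_ne_zero (ofReal_ne_zero.2 hc.ne'), ← exp_add, ← exp_add, ← exp_add, ← add_mul,
    ← add_mul, ← add_mul, hlog]

theorem conj_one_sub_cpow {x : ℂ} (hx : ‖x‖ < 1) (s : ℝ) :
    conj ((1 - x) ^ (-(s : ℂ))) = (1 - conj x) ^ (-(s : ℂ)) := by
  have h : (1 - x).arg ≠ Real.pi := by
    have := abs_lt.1 (Complex.abs_arg_lt_pi_div_two_iff.2 (Or.inl (re_pos_one_sub hx)))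
    have := Real.pi_pos
    intro h
    linarith
  rw [show 1 - conj x = conj (1 - x) by simp, conj_cpow _ _ h, map_neg, conj_ofReal]

/-- The weight `((mobius0 a)')^(l/2)`, up to a constant of modulus one. -/
def mobiusWeight (l : ℝ) (a : UnitDisc) (z : ℂ) : ℂ :=
  ((1 - ‖(a : ℂ)‖ ^ 2 : ℝ) : ℂ) ^ ((l : ℂ) / 2) * (1 - conj (a : ℂ) * z) ^ (-(l : ℂ))

theorem mobiusWeight_mul_conj (l : ℝ) (a z w : UnitDisc) :
    mobiusWeight l a z * conj (mobiusWeight l a w) * kerExpr l (mobius0 a z) (mobius0 a w) =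
      kerExpr l z w := by
  have hc := one_sub_norm_sq_pos a
  have hr : 0 < (1 - a * conj (w : ℂ)).re := re_pos_one_sub (norm_mul_conj_lt_one a w)
  have key := cpow_mul_cpow_mul_cpow hc
    (re_pos_one_sub (norm_mul_conj_lt_one (mobiusDisc a z) (mobiusDisc a w)))
    (re_pos_one_sub (norm_conj_mul_lt_one a z.norm_lt_one)) hr
    (re_pos_one_sub (norm_mul_conj_lt_one z w)) (one_sub_mobius0_mul_conj a z w) (-(l : ℂ))
  have hconj : conj ((1 - conj (a : ℂ) * w) ^ (-(l : ℂ))) = (1 - a * conj (w : ℂ)) ^ (-(l : ℂ)) := by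
    rw [conj_one_sub_cpow (norm_conj_mul_lt_one a w.norm_lt_one)]
    simp
  have hcc : conj (((1 - ‖(a : ℂ)‖ ^ 2 : ℝ) : ℂ) ^ ((l : ℂ) / 2)) =
      ((1 - ‖(a : ℂ)‖ ^ 2 : ℝ) : ℂ) ^ ((l : ℂ) / 2) := by
    have : ((l : ℂ) / 2) = ((l / 2 : ℝ) : ℂ) := by push_cast; rfl
    rw [this, ← ofReal_cpow hc.le, conj_ofReal]
  have hC : ((1 - ‖(a : ℂ)‖ ^ 2 : ℝ) : ℂ) ≠ 0 := ofReal_ne_zero.2 hc.ne'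
  have hC2 : ((1 - ‖(a : ℂ)‖ ^ 2 : ℝ) : ℂ) ^ ((l : ℂ) / 2) *
      ((1 - ‖(a : ℂ)‖ ^ 2 : ℝ) : ℂ) ^ ((l : ℂ) / 2) *
      ((1 - ‖(a : ℂ)‖ ^ 2 : ℝ) : ℂ) ^ (-(l : ℂ)) = 1 := by
    rw [← cpow_add _ _ hC, ← cpow_add _ _ hC]
    simp
  simp only [mobiusWeight, kerExpr, map_mul, hconj, hcc]
  simp only [mobiusDisc, UnitDisc.coe_mk] at key
  linear_combination (((1 - ‖(a : ℂ)‖ ^ 2 : ℝ) : ℂ) ^ ((l : ℂ) / 2) *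
      ((1 - ‖(a : ℂ)‖ ^ 2 : ℝ) : ℂ) ^ ((l : ℂ) / 2)) * key + (1 - z * conj (w : ℂ)) ^ (-(l : ℂ)) * hC2

/-- Composition with a Möbius map and multiplication by the weight is unitary. -/
theorem exists_mobius_unitary (l : {x : ℝ // 0 < x}) (a : UnitDisc) :
    ∃ A U : HSpace l →L[ℂ] HSpace l, (∀ f, ‖A f‖ = ‖f‖) ∧ (∀ f, ‖U f‖ ≤ ‖f‖) ∧ (∀ f, U (A f) = f) ∧
      ∀ f (z : UnitDisc), U f z = mobiusWeight l a z * f (mobiusDisc a z) := by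
  -- By the transformation rule these vectors have Gram matrix `K^(l)`. The adjoint of the resulting
  -- isometry is the weighted composition operator, and `J* J = 1` is all that is used of unitarity.
  obtain ⟨J, hJ⟩ := exists_linearIsometry (l := l)
    (u := fun z => conj (mobiusWeight l a z) • kvec l (mobiusDisc a z)) (by
      intro z w
      rw [inner_smul_left, inner_smul_right, conj_conj, inner_kvec_left, kvec_apply, ← mul_assoc]
      exact mobiusWeight_mul_conj l a z w)
  refine ⟨J.toContinuousLinearMap, ContinuousLinearMap.adjoint J.toContinuousLinearMap,
    J.norm_map, fun f => ?_, fun f => ?_, fun f z => ?_⟩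
  · refine (ContinuousLinearMap.le_opNorm _ _).trans ?_
    rw [LinearIsometryEquiv.norm_map]
    exact mul_le_of_le_one_left (norm_nonneg _) J.norm_toContinuousLinearMap_le
  · refine ext_inner_left ℂ fun g => ?_
    rw [ContinuousLinearMap.adjoint_inner_right]
    exact J.inner_map_map g f
  · rw [← inner_kvec_left, ContinuousLinearMap.adjoint_inner_right,
      LinearIsometry.coe_toContinuousLinearMap, hJ, inner_smul_left, conj_conj, inner_kvec_left]

/-- Conjugating `M_z` by the weighted composition operator gives multiplication by the Möbius map,
so the bound `‖S‖` does not depend on `a`. -/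
theorem InH.mul_mobius0 {l : {x : ℝ // 0 < x}} {S : HSpace l →L[ℂ] HSpace l}
    (hS : ∀ f (z : UnitDisc), S f z = z * f z) (a : UnitDisc) {F : ℂ → ℂ} {C : ℝ} (h : InH l F C) :
    InH l (fun z => mobius0 a z * F z) (‖S‖ * C) := by
  obtain ⟨f, hf, hC⟩ := h
  obtain ⟨A, U, hA, hU, hUA, hUz⟩ := exists_mobius_unitary l a
  refine ⟨U (S (A f)), fun z => ?_, ?_⟩
  · rw [hUz, hS]
    have := hUz (A f) z
    rw [hUA, hf] at this
    simp only [this, mobiusDisc, UnitDisc.coe_mk]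
    ring
  · refine (hU _).trans ((S.le_opNorm _).trans ?_)
    rw [hA]
    gcongr

theorem hasDerivAt_mobius0 (a : UnitDisc) {z : ℂ} (hz : 1 - conj (a : ℂ) * z ≠ 0) :
    HasDerivAt (mobius0 a) (((1 - ‖(a : ℂ)‖ ^ 2 : ℝ) : ℂ) / (1 - conj (a : ℂ) * z) ^ 2) z := by
  have h := ((hasDerivAt_id z).sub_const (a : ℂ)).div
    (((hasDerivAt_id z).const_mul (conj (a : ℂ))).const_sub 1) hz
  refine h.congr_deriv ?_
  have h3 : ((1 - ‖(a : ℂ)‖ ^ 2 : ℝ) : ℂ) = 1 - a * conj (a : ℂ) := by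
    rw [mul_conj']; push_cast; ring
  rw [h3]
  simp only [id]
  congr 1
  ring

/-- The weight for `l + 2` is the derivative of the Möbius map times the weight for `l`. Hence
multiplication by the derivative is the contractive inclusion `H^(l) ⊆ H^(l+2)` seen through the two
weighted composition operators. -/
theorem InH.mul_deriv_mobius0 {l l' : {x : ℝ // 0 < x}} (hl : (l' : ℝ) = l + 2) (a : UnitDisc)
    {F : ℂ → ℂ} {C : ℝ} (h : InH l F C) : InH l' (fun z => deriv (mobius0 a) z * F z) C := by
  obtain ⟨f, hf, hC⟩ := h
  obtain ⟨A, U, hA, hU, hUA, hUz⟩ := exists_mobius_unitary l a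
  obtain ⟨-, U', -, hU', -, hUz'⟩ := exists_mobius_unitary l' a
  obtain ⟨g, hg, hgC⟩ : InH l' (fun z => if h : ‖z‖ < 1 then A f (UnitDisc.mk z h) else 0) ‖f‖ :=
    InH.inclusion (by linarith) ⟨A f, fun z => by simp [z.norm_lt_one], (hA f).le⟩
  refine ⟨U' g, fun z => ?_, (hU' g).trans (hgC.trans hC)⟩
  have hz := one_sub_conj_mul_ne_zero a z.norm_lt_one
  have hc : ((1 - ‖(a : ℂ)‖ ^ 2 : ℝ) : ℂ) ≠ 0 := ofReal_ne_zero.2 (one_sub_norm_sq_pos a).ne'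
  have e1 : (((l : ℝ) + 2 : ℝ) : ℂ) / 2 = (l : ℝ) / 2 + 1 := by push_cast; ring
  have e2 : -(((l : ℝ) + 2 : ℝ) : ℂ) = -((l : ℝ) : ℂ) - (2 : ℕ) := by push_cast; ring
  have hF := hUz (A f) z
  rw [hUA, hf] at hF
  simp only [hUz', hg, hF, (hasDerivAt_mobius0 a hz).deriv, (mobiusDisc a z).norm_lt_one, dite_true,
    UnitDisc.mk_coe, mobiusWeight]
  rw [hl, e1, e2, cpow_add _ _ hc, cpow_sub _ _ hz, cpow_one, cpow_natCast]
  ring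

theorem mobius_eq (θ : ℝ) (a : UnitDisc) : mobius θ a = fun z => exp (θ * I) * mobius0 a z := rfl

theorem InH.mul_mobius {l : {x : ℝ // 0 < x}} {S : HSpace l →L[ℂ] HSpace l}
    (hS : ∀ f (z : UnitDisc), S f z = z * f z) (θ : ℝ) (a : UnitDisc) {F : ℂ → ℂ} {C : ℝ}
    (h : InH l F C) : InH l (fun z => mobius θ a z * F z) (‖S‖ * C) := by
  have := (h.mul_mobius0 hS a).const_mul (exp (θ * I))
  rw [norm_exp_ofReal_mul_I, one_mul] at this
  exact this.congr fun z _ => by rw [mobius_eq]; ring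

theorem differentiableOn_mobius (θ : ℝ) (a : UnitDisc) :
    DifferentiableOn ℂ (mobius θ a) (ball 0 1) := fun _ hz =>
  ((hasDerivAt_mobius0 a (one_sub_conj_mul_ne_zero a
    (mem_ball_zero_iff.1 hz))).differentiableAt.const_mul _).differentiableWithinAt

theorem _root_.DifferentiableOn.iteratedDeriv_complex {F : ℂ → ℂ} {s : Set ℂ}
    (h : DifferentiableOn ℂ F s) (hs : IsOpen s) (k : ℕ) :
    DifferentiableOn ℂ (iteratedDeriv k F) s := by
  induction k with
  | zero => simpa using h
  | succ k ih => rw [iteratedDeriv_succ]; exact ih.deriv hs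

theorem InH.mul_deriv_mobius {l l' : {x : ℝ // 0 < x}} (hl : (l' : ℝ) = l + 2) (θ : ℝ)
    (a : UnitDisc) {F : ℂ → ℂ} {C : ℝ} (h : InH l F C) :
    InH l' (fun z => deriv (mobius θ a) z * F z) C := by
  have := (h.mul_deriv_mobius0 hl a).const_mul (exp (θ * I))
  rw [norm_exp_ofReal_mul_I, one_mul] at this
  refine this.congr fun z hz => ?_
  rw [mobius_eq, deriv_const_mul]
  · ring
  · exact (hasDerivAt_mobius0 a (one_sub_conj_mul_ne_zero a hz)).differentiableAt

theorem InH.exists_bound_iteratedDeriv (l : {x : ℝ // 0 < x}) (k : ℕ) :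
    ∃ B : ℝ, ∀ l' : {x : ℝ // 0 < x}, (l' : ℝ) = l + 2 * k → ∀ (F : ℂ → ℂ) (C : ℝ), InH l F C →
      InH l' (iteratedDeriv k F) (B * C) := by
  induction k with
  | zero =>
    refine ⟨1, fun l' hl' F C h => ?_⟩
    rw [iteratedDeriv_zero, one_mul]
    exact h.inclusion (by simp [hl'])
  | succ k ih =>
    obtain ⟨B, hB⟩ := ih
    let m : {x : ℝ // 0 < x} := ⟨l + 2 * k, by have := l.2; positivity⟩
    refine ⟨√(m * (m + 1)) * B, fun l' hl' F C h => ?_⟩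
    rw [iteratedDeriv_succ, mul_assoc]
    exact (hB m rfl F C h).deriv_inH (by rw [hl']; simp only [m]; push_cast; ring)

/-- Multiplication by the `(k+1)`-st derivative of a Möbius map is bounded from `H^(l)` to
`H^(l + 2k + 2)`, uniformly over all Möbius maps. -/
theorem InH.exists_bound_mul_iteratedDeriv_mobius (l : {x : ℝ // 0 < x}) (k : ℕ) :
    ∃ B : ℝ, ∀ l' : {x : ℝ // 0 < x}, (l' : ℝ) = l + 2 * (k + 1) → ∀ (θ : ℝ) (a : UnitDisc)
      (F : ℂ → ℂ) (C : ℝ), InH l F C →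
        InH l' (fun z => iteratedDeriv (k + 1) (mobius θ a) z * F z) (B * C) := by
  induction k generalizing l with
  | zero =>
    refine ⟨1, fun l' hl' θ a F C h => ?_⟩
    rw [zero_add, iteratedDeriv_one, one_mul]
    exact h.mul_deriv_mobius (by rw [hl']; push_cast; ring) θ a
  | succ k ih =>
    have hl := l.2
    let m : {x : ℝ // 0 < x} := ⟨l + 2 * (k + 1), by positivity⟩
    let p : {x : ℝ // 0 < x} := ⟨l + 2, by positivity⟩
    obtain ⟨B, hB⟩ := ih l
    obtain ⟨B', hB'⟩ := ih p
    -- The Leibniz rule gives `φ^(k+2) F = (φ^(k+1) F)' - φ^(k+1) F'`; the two summands of the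
    -- constant bound these two terms.
    refine ⟨√(m * (m + 1)) * B + B' * √(l * (l + 1)), fun l' hl' θ a F C h => ?_⟩
    have h1 := (hB m rfl θ a F C h).deriv_inH (l' := l') (by rw [hl']; simp only [m]; push_cast; ring)
    have h2 := hB' l' (by rw [hl']; simp only [p]; push_cast; ring) θ a _ _
      (h.deriv_inH (l' := p) rfl)
    rw [show (√(m * (m + 1)) * B + B' * √(l * (l + 1))) * C =
      √(m * (m + 1)) * (B * C) + B' * (√(l * (l + 1)) * C) by ring]
    refine (h1.sub h2).congr fun z hz => ?_
    have hzm : ball (0 : ℂ) 1 ∈ nhds z := isOpen_ball.mem_nhds (mem_ball_zero_iff.2 hz)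
    have d1 := ((differentiableOn_mobius θ a).iteratedDeriv_complex isOpen_ball
      (k + 1)).differentiableAt hzm
    have d2 := h.differentiableOn.differentiableAt hzm
    rw [iteratedDeriv_succ (n := k + 1), deriv_fun_mul d1 d2]
    ring

/-! ### Resolvents of triangular systems of differential operators -/

/-- The differential expression `∑ l ≤ k, c l * (ζ - z)^(-l-1) * f^(k-l)(z)`. -/
def resExp (c : ℕ → ℂ) (k : ℕ) (ζ : ℂ) (f : ℂ → ℂ) (z : ℂ) : ℂ :=
  ∑ l ∈ Finset.range (k + 1), c l * (ζ - z)⁻¹ ^ (l + 1) * iteratedDeriv (k - l) f z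

theorem sub_ne_zero_of_mem_ball {ζ z : ℂ} (hζ : 1 ≤ ‖ζ‖) (hz : z ∈ ball (0 : ℂ) 1) : ζ - z ≠ 0 := by
  intro h
  rw [sub_eq_zero.1 h] at hζ
  exact absurd (mem_ball_zero_iff.1 hz) (not_lt.2 hζ)

theorem hasDerivAt_inv_sub_pow {ζ z : ℂ} (h : ζ - z ≠ 0) (l : ℕ) :
    HasDerivAt (fun z => (ζ - z)⁻¹ ^ (l + 1)) ((l + 1) * (ζ - z)⁻¹ ^ (l + 2)) z := by
  refine ((((hasDerivAt_id z).const_sub ζ).fun_inv h).fun_pow (l + 1)).congr_deriv ?_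
  simp only [id, Nat.add_sub_cancel, Nat.cast_add, Nat.cast_one, div_eq_mul_inv, ← inv_pow]
  ring

theorem hasDerivAt_resExp_term {f : ℂ → ℂ} (hf : DifferentiableOn ℂ f (ball 0 1)) {ζ z : ℂ}
    (hζ : 1 ≤ ‖ζ‖) (hz : z ∈ ball (0 : ℂ) 1) (c : ℂ) (l q : ℕ) :
    HasDerivAt (fun z => c * (ζ - z)⁻¹ ^ (l + 1) * iteratedDeriv q f z)
      ((l + 1) * c * (ζ - z)⁻¹ ^ (l + 2) * iteratedDeriv q f z +
        c * (ζ - z)⁻¹ ^ (l + 1) * iteratedDeriv (q + 1) f z) z := by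
  have h1 := (hasDerivAt_inv_sub_pow (sub_ne_zero_of_mem_ball hζ hz) l).const_mul c
  have h2 := ((hf.iteratedDeriv_complex isOpen_ball q).differentiableAt
    (isOpen_ball.mem_nhds hz)).hasDerivAt
  refine (h1.mul h2).congr_deriv ?_
  rw [iteratedDeriv_succ]
  ring

theorem differentiableOn_resExp {f : ℂ → ℂ} (hf : DifferentiableOn ℂ f (ball 0 1)) {ζ : ℂ}
    (hζ : 1 ≤ ‖ζ‖) (c : ℕ → ℂ) (k : ℕ) : DifferentiableOn ℂ (resExp c k ζ f) (ball 0 1) :=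
  DifferentiableOn.fun_sum fun _ _ _ hz =>
    (hasDerivAt_resExp_term hf hζ hz _ _ _).differentiableAt.differentiableWithinAt

/-- In the new coefficient, `c l` comes from differentiating `f` and `l * c (l - 1)` from
differentiating the power. The cut-off is needed because `c (k + 1)` is arbitrary and now lies in
the range of summation. -/
theorem deriv_resExp {f : ℂ → ℂ} (hf : DifferentiableOn ℂ f (ball 0 1)) {ζ z : ℂ}
    (hζ : 1 ≤ ‖ζ‖) (hz : z ∈ ball (0 : ℂ) 1) (c : ℕ → ℂ) (k : ℕ) :
    deriv (resExp c k ζ f) z =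
      resExp (fun l => (if l ≤ k then c l else 0) + l * c (l - 1)) (k + 1) ζ f z := by
  have h := HasDerivAt.fun_sum (u := Finset.range (k + 1))
    (fun l _ => hasDerivAt_resExp_term hf hζ hz (c l) l (k - l))
  refine h.deriv.trans ?_
  simp only [resExp, add_mul, Finset.sum_add_distrib]
  rw [add_comm]
  congr 1
  · rw [Finset.sum_range_succ _ (k + 1)]
    simp only [add_le_iff_nonpos_right, nonpos_iff_eq_zero, one_ne_zero, if_false, zero_mul,
      add_zero]
    refine Finset.sum_congr rfl fun l hl => ?_
    have hl' : l ≤ k := Nat.lt_succ_iff.1 (Finset.mem_range.1 hl)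
    rw [if_pos hl', Nat.sub_add_comm hl']
  · rw [Finset.sum_range_succ' _ (k + 1)]
    simp only [Nat.cast_zero, zero_mul, add_zero]
    rw [← Finset.sum_add_distrib]
    refine Finset.sum_congr rfl fun l _ => ?_
    rw [Nat.add_sub_cancel, Nat.add_sub_add_right]
    push_cast
    ring

theorem iteratedDeriv_congr_of_eqOn_ball {F G : ℂ → ℂ} (h : Set.EqOn F G (ball 0 1)) (p : ℕ) :
    Set.EqOn (iteratedDeriv p F) (iteratedDeriv p G) (ball 0 1) := fun _ hz =>
  ((h.eventuallyEq_of_mem (isOpen_ball.mem_nhds hz)).iteratedDeriv_eq p)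

/-- The point is that `c'` depends neither on `f` nor on `ζ`. The clause for `p = 0` is kept to
identify the coefficient of adjacent indices later. -/
theorem exists_iteratedDeriv_resExp (c : ℕ → ℂ) (k p : ℕ) :
    ∃ c' : ℕ → ℂ, (p = 0 → c' = c) ∧ ∀ f : ℂ → ℂ, DifferentiableOn ℂ f (ball 0 1) →
      ∀ ζ : ℂ, 1 ≤ ‖ζ‖ → Set.EqOn (iteratedDeriv p (resExp c k ζ f)) (resExp c' (k + p) ζ f)
        (ball 0 1) := by
  induction p with
  | zero => exact ⟨c, fun _ => rfl, fun f _ ζ _ z _ => by simp⟩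
  | succ p ih =>
    obtain ⟨c', -, h⟩ := ih
    refine ⟨fun l => (if l ≤ k + p then c' l else 0) + l * c' (l - 1), by simp, fun f hf ζ hζ z hz => ?_⟩
    rw [iteratedDeriv_succ, ((h f hf ζ hζ).eventuallyEq_of_mem (isOpen_ball.mem_nhds hz)).deriv_eq,
      deriv_resExp hf hζ hz, add_assoc]

/-- The shift leaves a zero at `l = 0`; this is why off-diagonal entries of `φ(T)*` contain no
undifferentiated `φ`. -/
theorem inv_mul_resExp (c : ℕ → ℂ) (k : ℕ) (ζ : ℂ) (f : ℂ → ℂ) (z : ℂ) :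
    (ζ - z)⁻¹ * resExp c k ζ f z =
      resExp (fun l => if l = 0 then 0 else c (l - 1)) (k + 1) ζ f z := by
  rw [resExp, resExp, Finset.sum_range_succ' _ (k + 1), Finset.mul_sum]
  simp only [if_true, zero_mul, add_zero]
  refine Finset.sum_congr rfl fun l _ => ?_
  rw [if_neg l.succ_ne_zero, Nat.add_sub_cancel, Nat.add_sub_add_right]
  ring

theorem resExp_sum {ι : Type*} (s : Finset ι) (b : ι → ℂ) (c : ι → ℕ → ℂ) (k : ℕ) (ζ : ℂ)
    (f : ℂ → ℂ) (z : ℂ) :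
    ∑ i ∈ s, b i * resExp (c i) k ζ f z = resExp (fun l => ∑ i ∈ s, b i * c i l) k ζ f z := by
  simp only [resExp, Finset.mul_sum, Finset.sum_mul]
  rw [Finset.sum_comm]
  simp only [mul_assoc]

/-- `g` solves the triangular system `(ζ - z) g_j = f_j + ∑_{i<j} κ_{ij} g_i^{(j-i-1)}` on the
disc. -/
structure IsTriangularSolution {n : ℕ} (κ : Fin n → Fin n → ℂ) (ζ : ℂ) (f g : Fin n → ℂ → ℂ) :
    Prop where
  diff_left : ∀ j, DifferentiableOn ℂ (f j) (ball 0 1)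
  diff_right : ∀ j, DifferentiableOn ℂ (g j) (ball 0 1)
  eq : ∀ j, ∀ z ∈ ball (0 : ℂ) 1, (ζ - z) * g j z = f j z +
    ∑ i ∈ Finset.univ.filter (· < j), κ i j * iteratedDeriv ((j : ℕ) - i - 1) (g i) z

/-- Forward substitution: divide the `j`-th equation by `ζ - z` and insert the formulas for `g i'`,
`i' < j`. Orders add up as `(i' - i) + (j - i' - 1) + 1 = j - i`. The coefficients are independent
of `ζ`, so the contour integral can later be taken term by term. -/
theorem exists_resolvent_coeff {n : ℕ} (κ : Fin n → Fin n → ℂ) (j : Fin n) :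
    ∃ c : Fin n → ℕ → ℂ, c j 0 = 1 ∧ (∀ i < j, c i 0 = 0) ∧
      (∀ i : Fin n, (j : ℕ) = i + 1 → c i 1 = κ i j) ∧
      ∀ ζ : ℂ, 1 ≤ ‖ζ‖ → ∀ f g, IsTriangularSolution κ ζ f g → ∀ z ∈ ball (0 : ℂ) 1,
        g j z = ∑ i ∈ Finset.univ.filter (· ≤ j), resExp (c i) (j - i) ζ (f i) z := by
  induction j using WellFoundedLT.induction with
  | ind j ih =>
  have ih' : ∀ i' : Fin n, ∃ c : Fin n → ℕ → ℂ, i' < j → (c i' 0 = 1 ∧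
      ∀ ζ : ℂ, 1 ≤ ‖ζ‖ → ∀ f g, IsTriangularSolution κ ζ f g → ∀ z ∈ ball (0 : ℂ) 1,
        g i' z = ∑ i ∈ Finset.univ.filter (· ≤ i'), resExp (c i) (i' - i) ζ (f i) z) := by
    intro i'
    by_cases h : i' < j
    · obtain ⟨c, h0, -, -, h1⟩ := ih i' h
      exact ⟨c, fun _ => ⟨h0, h1⟩⟩
    · exact ⟨0, fun h' => absurd h' h⟩
  choose C hC using ih'
  choose C' hC'0 hC' using fun i' i : Fin n =>
    exists_iteratedDeriv_resExp (C i' i) (i' - i) ((j : ℕ) - i' - 1)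
  refine ⟨fun i => if i = j then fun l => if l = 0 then 1 else 0 else
    fun l => ∑ i' ∈ Finset.univ.filter (fun i' => i ≤ i' ∧ i' < j),
      κ i' j * (if l = 0 then 0 else C' i' i (l - 1)), by simp, fun i hi => ?_, fun i hi => ?_, ?_⟩
  · simp [hi.ne]
  · have hij : i < j := Fin.lt_def.2 (by omega)
    -- For adjacent indices the only intermediate index is `i` itself, and no differentiation takes
    -- place.
    have hs : Finset.univ.filter (fun i' => i ≤ i' ∧ i' < j) = {i} := by
      ext x
      simp only [Finset.mem_filter, Finset.mem_univ, true_and, Finset.mem_singleton, Fin.ext_iff,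
        Fin.le_def, Fin.lt_def]
      omega
    simp [hij.ne, hs, hC'0 i i (by omega), (hC i hij).1]
  · intro ζ hζ f g hs z hz
    have hne := sub_ne_zero_of_mem_ball hζ hz
    have h1 : g j z = (ζ - z)⁻¹ * f j z + ∑ i' ∈ Finset.univ.filter (· < j),
        ∑ i ∈ Finset.univ.filter (· ≤ i'), κ i' j *
          resExp (fun l => if l = 0 then 0 else C' i' i (l - 1)) (j - i) ζ (f i) z := by
      have h := hs.eq j z hz
      rw [mul_comm, ← eq_mul_inv_iff_mul_eq₀ hne] at h
      rw [h, mul_comm, mul_add, Finset.mul_sum]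
      congr 1
      refine Finset.sum_congr rfl fun i' hi' => ?_
      have hi'j := (Finset.mem_filter.1 hi').2
      have hg : Set.EqOn (g i') (fun z => ∑ i ∈ Finset.univ.filter (· ≤ i'),
          resExp (C i' i) (i' - i) ζ (f i) z) (ball 0 1) := (hC i' hi'j).2 ζ hζ f g hs
      rw [iteratedDeriv_congr_of_eqOn_ball hg _ hz, iteratedDeriv_fun_sum, Finset.mul_sum,
        Finset.mul_sum]
      · refine Finset.sum_congr rfl fun i hi => ?_
        have hii' := (Finset.mem_filter.1 hi).2
        rw [hC' i' i (f i) (hs.diff_left i) ζ hζ hz, mul_left_comm, inv_mul_resExp]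
        congr 2
        rw [Fin.le_def] at hii'
        rw [Fin.lt_def] at hi'j
        omega
      · intro i _
        exact ((differentiableOn_resExp (hs.diff_left i) hζ _ _).analyticAt
          (isOpen_ball.mem_nhds hz)).contDiffAt
    rw [h1]
    have h2 : Finset.univ.filter (fun i : Fin n => i ≤ j) =
        insert j (Finset.univ.filter (· < j)) := by
      ext x
      simp [le_iff_eq_or_lt]
    rw [h2, Finset.sum_insert (by simp)]
    congr 1
    · simp [resExp]
    · rw [Finset.sum_comm' (t' := Finset.univ.filter (· < j))
        (s' := fun i => Finset.univ.filter (fun i' => i ≤ i' ∧ i' < j))]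
      · refine Finset.sum_congr rfl fun i hi => ?_
        simp only [resExp_sum, if_neg (Finset.mem_filter.1 hi).2.ne]
      · intro x y
        simp only [Finset.mem_filter, Finset.mem_univ, true_and, Fin.le_def, Fin.lt_def]
        omega

/-- Cauchy's formula for derivatives. -/
theorem circleIntegral_mul_inv_sub_pow {R r : ℝ} (hr : 0 < r) (hrR : r < R) {w : ℂ} (hw : ‖w‖ < r)
    (l : ℕ) {f : ℂ → ℂ} (hf : DifferentiableOn ℂ f (ball 0 R)) :
    (∮ ζ in C(0, r), f ζ * (ζ - w)⁻¹ ^ (l + 1)) =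
      2 * Real.pi * I / l.factorial * iteratedDeriv l f w := by
  have hsub : sphere (0 : ℂ) r ⊆ ball 0 R := fun ζ hζ => by
    rw [mem_ball_zero_iff, mem_sphere_zero_iff_norm.1 hζ]; exact hrR
  have hne : ∀ ζ ∈ sphere (0 : ℂ) r, ζ - w ≠ 0 := fun ζ hζ h => by
    rw [← sub_eq_zero.1 h, mem_sphere_zero_iff_norm.1 hζ] at hw
    exact lt_irrefl _ hw
  have hci : ∀ (g : ℂ → ℂ), DifferentiableOn ℂ g (ball 0 R) → ∀ k : ℕ,
      CircleIntegrable (fun ζ => g ζ * (ζ - w)⁻¹ ^ k) 0 r := fun g hg k =>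
    ContinuousOn.circleIntegrable hr.le ((hg.continuousOn.mono hsub).mul
      (((continuousOn_id.sub continuousOn_const).inv₀ hne).pow k))
  induction l generalizing f with
  | zero =>
    have h := (hf.mono (closedBall_subset_ball hrR)).circleIntegral_sub_inv_smul
      (mem_ball_zero_iff.2 hw)
    simp only [smul_eq_mul] at h
    simp only [zero_add, pow_one, Nat.factorial_zero, Nat.cast_one, div_one, iteratedDeriv_zero]
    rw [← h]
    simp only [mul_comm]
  | succ l ih =>
    have hf' := hf.deriv isOpen_ball
    -- Integration by parts: the integrand is the derivative of `f ζ * (ζ - w)⁻¹ ^ (l + 1)`.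
    have h0 : (∮ ζ in C(0, r), (deriv f ζ * (ζ - w)⁻¹ ^ (l + 1) -
        (l + 1) * (f ζ * (ζ - w)⁻¹ ^ (l + 1 + 1)))) = 0 := by
      refine circleIntegral.integral_eq_zero_of_hasDerivWithinAt
        (f := fun ζ => f ζ * (ζ - w)⁻¹ ^ (l + 1)) hr.le fun ζ hζ => ?_
      have h1 := (hf.differentiableAt (isOpen_ball.mem_nhds (hsub hζ))).hasDerivAt
      have h2 := (((hasDerivAt_id ζ).sub_const w).fun_inv (hne ζ hζ)).pow (l + 1)
      refine ((h1.mul h2).congr_deriv ?_).hasDerivWithinAt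
      simp only [id, Nat.add_sub_cancel, Pi.pow_apply, Nat.cast_add, Nat.cast_one,
        div_eq_mul_inv, ← inv_pow]
      ring
    have hci2 : CircleIntegrable (fun ζ => (l + 1) * (f ζ * (ζ - w)⁻¹ ^ (l + 1 + 1))) 0 r :=
      (hci _ hf _).const_mul _
    rw [circleIntegral.integral_sub (hci _ hf' _) hci2,
      circleIntegral.integral_const_mul, ih hf', ← iteratedDeriv_succ', sub_eq_zero] at h0
    rw [Nat.factorial_succ]
    have : (l + 1 : ℂ) ≠ 0 := by exact_mod_cast l.succ_ne_zero
    rw [← mul_right_inj' this, ← h0]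
    push_cast
    field_simp

/-! ### Elements of `H^(l)` as holomorphic functions -/

/-- The extension by zero of an element of `H^(l)` to the complex plane. -/
def toFun {l : {x : ℝ // 0 < x}} (f : HSpace l) (z : ℂ) : ℂ :=
  if h : ‖z‖ < 1 then f (UnitDisc.mk z h) else 0

theorem toFun_coe {l : {x : ℝ // 0 < x}} (f : HSpace l) (z : UnitDisc) : toFun f z = f z := by
  simp [toFun, z.norm_lt_one]

theorem inH_toFun {l : {x : ℝ // 0 < x}} (f : HSpace l) : InH l (toFun f) ‖f‖ :=
  ⟨f, fun z => (toFun_coe f z).symm, le_rfl⟩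

theorem differentiableOn_toFun {l : {x : ℝ // 0 < x}} (f : HSpace l) :
    DifferentiableOn ℂ (toFun f) (ball 0 1) := (inH_toFun f).differentiableOn

theorem toFun_add {l : {x : ℝ // 0 < x}} (f g : HSpace l) : toFun (f + g) = toFun f + toFun g := by
  ext z; by_cases h : ‖z‖ < 1 <;> simp [toFun, h]

theorem toFun_smul {l : {x : ℝ // 0 < x}} (c : ℂ) (f : HSpace l) :
    toFun (c • f) = c • toFun f := by
  ext z; by_cases h : ‖z‖ < 1 <;> simp [toFun, h]

theorem toFun_zero (l : {x : ℝ // 0 < x}) : toFun (0 : HSpace l) = 0 := by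
  ext z; simp [toFun]

theorem contDiffAt_of_differentiableOn {F : ℂ → ℂ} (h : DifferentiableOn ℂ F (ball 0 1))
    (w : UnitDisc) (k : ℕ) : ContDiffAt ℂ k F w :=
  (h.analyticAt (isOpen_ball.mem_nhds (mem_ball_zero_iff.2 w.norm_lt_one))).contDiffAt

theorem norm_apply_le_of_inH {l : {x : ℝ // 0 < x}} {F : ℂ → ℂ} {C : ℝ} (h : InH l F C)
    (w : UnitDisc) : ‖F w‖ ≤ ‖kvec l w‖ * C := by
  obtain ⟨g, hg, hC⟩ := h
  rw [← hg, ← inner_kvec_left]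
  exact (norm_inner_le_norm _ _).trans (by gcongr)

/-- Point evaluations of derivatives are bounded on `H^(l)`. -/
theorem exists_clm_iteratedDeriv (l : {x : ℝ // 0 < x}) (k : ℕ) (w : UnitDisc) :
    ∃ A : HSpace l →L[ℂ] ℂ, ∀ f, A f = iteratedDeriv k (toFun f) w := by
  obtain ⟨B, hB⟩ := InH.exists_bound_iteratedDeriv l k
  let m : {x : ℝ // 0 < x} := ⟨l + 2 * k, by have := l.2; positivity⟩
  have hc := fun f : HSpace l => contDiffAt_of_differentiableOn (differentiableOn_toFun f) w k
  let A : HSpace l →ₗ[ℂ] ℂ :=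
    { toFun := fun f => iteratedDeriv k (toFun f) w
      map_add' := fun f g => by rw [toFun_add, iteratedDeriv_add (hc f) (hc g)]
      map_smul' := fun c f => by
        rw [toFun_smul]; exact iteratedDeriv_const_smul_field c (toFun f) }
  refine ⟨A.mkContinuous (‖kvec m w‖ * B) fun f => ?_, fun f => rfl⟩
  rw [mul_assoc]
  exact norm_apply_le_of_inH (hB m rfl _ _ (inH_toFun f)) w

theorem conj_kerExpr (l : ℝ) (z w : UnitDisc) : conj (kerExpr l z w) = kerExpr l w z := by
  rw [kerExpr, conj_one_sub_cpow (norm_mul_conj_lt_one z w), kerExpr]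
  congr 2
  simp [mul_comm]

theorem dbar_of_eqOn {f G : ℂ → ℂ} (hG : DifferentiableOn ℂ G (ball 0 1))
    (h : Set.EqOn f (fun w => conj (G w)) (ball 0 1)) :
    Set.EqOn (dbar f) (fun w => conj (deriv G w)) (ball 0 1) := by
  intro w hw
  have hwm := isOpen_ball.mem_nhds hw
  have h1 := (hG.differentiableAt hwm).hasDerivAt.hasFDerivAt.restrictScalars ℝ
  have h2 : HasFDerivAt (fun w => conj (G w)) _ w :=
    (conjCLE : ℂ →L[ℝ] ℂ).hasFDerivAt.comp w h1
  have h3 := (h2.congr_of_eventuallyEq (h.eventuallyEq_of_mem hwm)).fderiv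
  simp only [dbar, h3]
  simp
  linear_combination (-(1 / 2) * conj (deriv G w)) * I_sq

theorem dbar_iterate_of_eqOn {f G : ℂ → ℂ} (hG : DifferentiableOn ℂ G (ball 0 1))
    (h : Set.EqOn f (fun w => conj (G w)) (ball 0 1)) (k : ℕ) :
    Set.EqOn (dbar^[k] f) (fun w => conj (iteratedDeriv k G w)) (ball 0 1) := by
  induction k with
  | zero => simpa using h
  | succ k ih =>
    rw [Function.iterate_succ_apply', iteratedDeriv_succ]
    exact dbar_of_eqOn (hG.iteratedDeriv_complex isOpen_ball k) ih

theorem toFun_kvec {l : {x : ℝ // 0 < x}} (z w : UnitDisc) : toFun (kvec l z) w = kerExpr l w z := by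
  rw [toFun_coe, kvec_apply]

/-! ### The adjoint of a quasi-homogeneous operator -/

theorem HSum.inner_single_left {n : ℕ} {lam : Fin n → {x : ℝ // 0 < x}} (j : Fin n)
    (x : HSpace (lam j)) (F : HSum lam) : inner ℂ (PiLp.single 2 j x : HSum lam) F = inner ℂ x (F j) := by
  rw [PiLp.inner_apply, Finset.sum_eq_single j]
  · rw [PiLp.single_eq_same]
  · intro i _ hi
    rw [PiLp.single_eq_of_ne 2 hi, inner_zero_left]
  · simp

theorem block_apply {n : ℕ} {lam : Fin n → {x : ℝ // 0 < x}} (T : HSum lam →L[ℂ] HSum lam)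
    (i j : Fin n) (x : HSpace (lam j)) : block T i j x = T (PiLp.single 2 j x) i := rfl

/-- Thus the adjoint of `S i j` is a multiple of differentiation of order `j - i - 1`. Both sides
are continuous in `f`, so it suffices to take `f` a kernel function, where the defining formula
applies because `∂bar` of a conjugate is the conjugate of the derivative. -/
theorem IsQuasiHomogeneous.inner_block_kvec {n : ℕ} {lam : Fin n → {x : ℝ // 0 < x}}
    {m : Fin n → Fin n → ℂ} {T : HSum lam →L[ℂ] HSum lam} (hT : IsQuasiHomogeneous lam m T)
    {i j : Fin n} (hij : i < j) (w : UnitDisc) (f : HSpace (lam i)) :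
    inner ℂ (block T i j (kvec (lam j) w)) f =
      conj (m i j) * iteratedDeriv ((j : ℕ) - i - 1) (toFun f) w := by
  obtain ⟨A, hA⟩ := exists_clm_iteratedDeriv (lam i) ((j : ℕ) - i - 1) w
  have key : innerSL ℂ (block T i j (kvec (lam j) w)) = conj (m i j) • A := by
    refine eq_of_eq_on_kvec fun z => ?_
    rw [innerSL_apply_apply, inner_kvec_right, _root_.smul_apply, hA, kvec,
      hT.upper i j hij w z, map_mul, smul_eq_mul]
    have h : Set.EqOn (fun u => kerExpr (lam i) z u)
        (fun u => conj (toFun (kvec (lam i) z) u)) (ball 0 1) := by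
      intro u hu
      have := toFun_kvec (l := lam i) z (UnitDisc.mk u (mem_ball_zero_iff.1 hu))
      rw [UnitDisc.coe_mk] at this
      simp only [this]
      exact (conj_kerExpr _ (UnitDisc.mk u (mem_ball_zero_iff.1 hu)) z).symm
    rw [dbar_iterate_of_eqOn (differentiableOn_toFun _) h _
      (mem_ball_zero_iff.2 w.norm_lt_one), conj_conj]
  rw [← innerSL_apply_apply, key, _root_.smul_apply, hA, smul_eq_mul]

theorem IsQuasiHomogeneous.adjoint_apply {n : ℕ} {lam : Fin n → {x : ℝ // 0 < x}}
    {m : Fin n → Fin n → ℂ} {T : HSum lam →L[ℂ] HSum lam} (hT : IsQuasiHomogeneous lam m T)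
    (F : HSum lam) (j : Fin n) (w : UnitDisc) :
    (ContinuousLinearMap.adjoint T F) j w = w * F j w + ∑ i ∈ Finset.univ.filter (· < j),
      conj (m i j) * iteratedDeriv ((j : ℕ) - i - 1) (toFun (F i)) w := by
  rw [← inner_kvec_left, ← HSum.inner_single_left, ContinuousLinearMap.adjoint_inner_right,
    PiLp.inner_apply]
  simp only [← block_apply]
  rw [← Finset.sum_filter_add_sum_filter_not _ (· < j), add_comm]
  congr 1
  · rw [Finset.sum_eq_single j]
    · rw [← ContinuousLinearMap.adjoint_inner_right, inner_kvec_left]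
      exact hT.diag j (F j) w
    · intro i hi hij
      rw [hT.lower i j (lt_of_le_of_ne (not_lt.1 (Finset.mem_filter.1 hi).2) hij.symm)]
      simp
    · simp
  · exact Finset.sum_congr rfl fun i hi => hT.inner_block_kvec (Finset.mem_filter.1 hi).2 w (F i)

/-- `M_z - ζ` is invertible on `H^(l)` for `ζ` outside the closed disc. -/
theorem exists_div_sub {l : {x : ℝ // 0 < x}} {S : HSpace l →L[ℂ] HSpace l}
    (hS : ∀ f (z : UnitDisc), S f z = z * f z) {ζ : ℂ} (hζ : 1 < ‖ζ‖) (f : HSpace l) :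
    ∃ g : HSpace l, ∀ z : UnitDisc, (ζ - z) * g z = f z := by
  have hζ0 : ζ ≠ 0 := norm_pos_iff.1 (zero_lt_one.trans hζ)
  -- With this `a`, `ζ - z = ζ (1 - conj a * z)`, and `1 / (1 - conj a * z)` is an affine function
  -- of the Möbius map, which is already known to be a multiplier. A Neumann series would not reach
  -- all `|ζ| > 1`, since `‖M_z‖ > 1` when `l < 1`.
  let a : UnitDisc := UnitDisc.mk (conj ζ⁻¹) (by
    rw [RCLike.norm_conj, norm_inv]; exact inv_lt_one_of_one_lt₀ hζ)
  have ha : conj (a : ℂ) = ζ⁻¹ := by simp [a]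
  have h1 := (((inH_toFun f).mul_mobius0 hS a).const_mul (conj (a : ℂ))).add (inH_toFun f)
  obtain ⟨g, hg, -⟩ := h1.const_mul (ζ⁻¹ * ((1 - ‖(a : ℂ)‖ ^ 2 : ℝ) : ℂ)⁻¹)
  refine ⟨g, fun z => ?_⟩
  have hz := one_sub_conj_mul_ne_zero a z.norm_lt_one
  have hc : ((1 - ‖(a : ℂ)‖ ^ 2 : ℝ) : ℂ) ≠ 0 := ofReal_ne_zero.2 (one_sub_norm_sq_pos a).ne'
  have h3 : ((1 - ‖(a : ℂ)‖ ^ 2 : ℝ) : ℂ) = 1 - a * conj (a : ℂ) := by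
    rw [mul_conj']; push_cast; ring
  have key : conj (a : ℂ) * mobius0 a z + 1 =
      ((1 - ‖(a : ℂ)‖ ^ 2 : ℝ) : ℂ) * (1 - conj (a : ℂ) * z)⁻¹ := by
    rw [h3, mobius0, eq_mul_inv_iff_mul_eq₀ hz, add_mul, mul_assoc, div_mul_cancel₀ _ hz]
    ring
  simp only [hg, toFun_coe]
  have e : (ζ - z) * ζ⁻¹ = 1 - conj (a : ℂ) * z := by
    rw [ha]; field_simp
  calc _ = ((ζ - z) * ζ⁻¹) * (((1 - ‖(a : ℂ)‖ ^ 2 : ℝ) : ℂ)⁻¹ *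
        (conj (a : ℂ) * mobius0 a z + 1)) * f z := by ring
    _ = f z := by rw [e, key, inv_mul_cancel_left₀ hc, mul_inv_cancel₀ hz, one_mul]

theorem IsQuasiHomogeneous.bijective_sub_adjoint {n : ℕ} {lam : Fin n → {x : ℝ // 0 < x}}
    {m : Fin n → Fin n → ℂ} {T : HSum lam →L[ℂ] HSum lam} (hT : IsQuasiHomogeneous lam m T)
    {ζ : ℂ} (hζ : 1 < ‖ζ‖) :
    Function.Bijective (algebraMap ℂ (HSum lam →L[ℂ] HSum lam) ζ -
      ContinuousLinearMap.adjoint T) := by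
  set R := algebraMap ℂ (HSum lam →L[ℂ] HSum lam) ζ - ContinuousLinearMap.adjoint T with hR
  have happ : ∀ (F : HSum lam) (j : Fin n) (w : UnitDisc), (R F) j w = (ζ - w) * F j w -
      ∑ i ∈ Finset.univ.filter (· < j),
        conj (m i j) * iteratedDeriv ((j : ℕ) - i - 1) (toFun (F i)) w := by
    intro F j w
    have : R F = ζ • F - ContinuousLinearMap.adjoint T F := by
      simp [hR, Algebra.algebraMap_eq_smul_one]
    rw [this, PiLp.sub_apply, PiLp.smul_apply, RKHS.coe_sub, RKHS.coe_smul, Pi.sub_apply,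
      Pi.smul_apply, hT.adjoint_apply, smul_eq_mul]
    ring
  have hsum : ∀ (F : HSum lam) (j : Fin n), (∀ i < j, F i = 0) → ∀ w : UnitDisc,
      (R F) j w = (ζ - w) * F j w := by
    intro F j h w
    rw [happ, Finset.sum_eq_zero, sub_zero]
    intro i hi
    rw [h i (Finset.mem_filter.1 hi).2, toFun_zero]
    simp
  have hne : ∀ w : UnitDisc, ζ - w ≠ 0 := fun w =>
    sub_ne_zero_of_mem_ball hζ.le (mem_ball_zero_iff.2 w.norm_lt_one)
  constructor
  · refine (injective_iff_map_eq_zero R).2 fun F hF => ?_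
    have h0 : ∀ j, F j = 0 := by
      intro j
      induction j using WellFoundedLT.induction with
      | ind j ih =>
        refine RKHS.ext fun w => ?_
        have h := hsum F j ih w
        rw [hF] at h
        simpa [hne w, eq_comm] using h
    exact PiLp.ext h0
  -- Here `t` counts the trailing components that may be non-zero; each step solves for the first of
  -- them and subtracts its image.
  · have hsurj : ∀ (t : ℕ) (F : HSum lam), (∀ j : Fin n, (j : ℕ) + t < n → F j = 0) →
        ∃ G, R G = F := by
      intro t
      induction t with
      | zero => exact fun F h => ⟨0, by rw [map_zero]; exact (PiLp.ext fun j => h j j.2).symm⟩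
      | succ t ih =>
        intro F h
        by_cases ht : t < n
        · let j : Fin n := ⟨n - 1 - t, by omega⟩
          have hj : (j : ℕ) = n - 1 - t := rfl
          obtain ⟨g, hg⟩ := exists_div_sub (hT.diag j) hζ (F j)
          let E : HSum lam := PiLp.single 2 j g
          have hE : ∀ i < j, E i = 0 := fun i hi =>
            PiLp.single_eq_of_ne (β := fun i => HSpace (lam i)) 2 hi.ne g
          obtain ⟨G, hG⟩ := ih (F - R E) (by
            intro i hi
            have hle : i ≤ j := Fin.le_def.2 (by omega)
            refine RKHS.ext fun w => ?_
            rw [PiLp.sub_apply, RKHS.coe_sub, Pi.sub_apply,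
              hsum E i (fun k hk => hE k (hk.trans_le hle)) w]
            rcases hle.lt_or_eq with hlt | rfl
            · rw [hE i hlt, h i (by rw [Fin.lt_def] at hlt; omega)]
              simp
            · rw [show E j = g from PiLp.single_eq_same (β := fun i => HSpace (lam i)) 2 j g, hg]
              simp)
          exact ⟨G + E, by rw [map_add, hG, sub_add_cancel]⟩
        · exact ih F fun j hj => absurd hj (by omega)
    exact fun F => hsurj n F fun j hj => absurd hj (by omega)

theorem IsQuasiHomogeneous.isUnit_sub {n : ℕ} {lam : Fin n → {x : ℝ // 0 < x}}
    {m : Fin n → Fin n → ℂ} {T : HSum lam →L[ℂ] HSum lam} (hT : IsQuasiHomogeneous lam m T)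
    {ζ : ℂ} (hζ : 1 < ‖ζ‖) : IsUnit (algebraMap ℂ (HSum lam →L[ℂ] HSum lam) ζ - T) := by
  rw [← isUnit_star]
  have h := ContinuousLinearMap.isUnit_iff_bijective.2
    (hT.bijective_sub_adjoint (ζ := conj ζ) (by rwa [RCLike.norm_conj]))
  convert h using 1
  rw [ContinuousLinearMap.star_eq_adjoint, map_sub, Algebra.algebraMap_eq_smul_one,
    Algebra.algebraMap_eq_smul_one, map_smulₛₗ, ContinuousLinearMap.one_def,
    ContinuousLinearMap.adjoint_id]

theorem IsQuasiHomogeneous.spectrum_subset {n : ℕ} {lam : Fin n → {x : ℝ // 0 < x}}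
    {m : Fin n → Fin n → ℂ} {T : HSum lam →L[ℂ] HSum lam} (hT : IsQuasiHomogeneous lam m T) :
    spectrum ℂ T ⊆ closedBall 0 1 := by
  intro ζ hζ
  by_contra h
  exact hζ (hT.isUnit_sub (by simpa using h))

/-! ### The functional calculus of a quasi-homogeneous operator -/

theorem conj_mobius_conj (θ : ℝ) (a : UnitDisc) (w : ℂ) :
    conj (mobius θ a (conj w)) = mobius (-θ) (star a) w := by
  simp [mobius, ← exp_conj]

theorem conj_iteratedDeriv_mobius (θ : ℝ) (a : UnitDisc) (l : ℕ) (w : ℂ) :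
    conj (iteratedDeriv l (mobius θ a) (conj w)) = iteratedDeriv l (mobius (-θ) (star a)) w := by
  induction l generalizing w with
  | zero => simpa using conj_mobius_conj θ a w
  | succ l ih =>
    rw [iteratedDeriv_succ, iteratedDeriv_succ, ← funext ih]
    exact (congrFun (deriv_conj_conj (f := iteratedDeriv l (mobius θ a))) w).symm

theorem differentiableOn_mobius_of_le (θ : ℝ) (a : UnitDisc) {R : ℝ} (hR : R * ‖(a : ℂ)‖ ≤ 1) :
    DifferentiableOn ℂ (mobius θ a) (ball 0 R) := by
  intro z hz
  have hz' := mem_ball_zero_iff.1 hz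
  have hlt : ‖conj (a : ℂ) * z‖ < 1 := by
    rw [norm_mul, RCLike.norm_conj]
    rcases (norm_nonneg (a : ℂ)).eq_or_lt with h | h
    · simp [← h]
    · nlinarith
  exact ((hasDerivAt_mobius0 a (ne_zero_of_re_pos
    (re_pos_one_sub hlt))).differentiableAt.const_mul _).differentiableWithinAt

theorem inner_holCalc_apply {E : Type*} [NormedAddCommGroup E] [InnerProductSpace ℂ E]
    [CompleteSpace E] {f : ℂ → ℂ} {T : E →L[ℂ] E} {r : ℝ} (hr : 0 ≤ r)
    (hf : ContinuousOn f (sphere 0 r)) (hT : ∀ ζ ∈ sphere (0 : ℂ) r, ζ ∈ resolventSet ℂ T)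
    (F x : E) :
    inner ℂ F (holCalc f T r x) =
      (2 * Real.pi * I : ℂ)⁻¹ * ∮ ζ in C(0, r), f ζ * inner ℂ F (resolvent T ζ x) := by
  have hres : ContinuousOn (fun ζ => f ζ • resolvent T ζ) (sphere 0 r) :=
    hf.smul fun ζ hζ =>
      (spectrum.hasDerivAt_resolvent_const_left (hT ζ hζ)).continuousAt.continuousWithinAt
  let L : (E →L[ℂ] E) →L[ℂ] ℂ := (innerSL ℂ F).comp (ContinuousLinearMap.apply ℂ E x)
  have h := L.intervalIntegral_comp_comm (hres.circleIntegrable hr).out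
  have hL : ∀ A : E →L[ℂ] E, L A = inner ℂ F (A x) := fun A => rfl
  rw [← hL, holCalc, map_smul, smul_eq_mul, circleIntegral, ← h, circleIntegral]
  congr 1
  simp only [hL, smul_apply, inner_smul_right, smul_eq_mul]

theorem adjoint_resolvent_apply {E : Type*} [NormedAddCommGroup E] [InnerProductSpace ℂ E]
    [CompleteSpace E] {T : E →L[ℂ] E} {ζ : ℂ} (hζ : ζ ∈ resolventSet ℂ T) (F : E) :
    conj ζ • ContinuousLinearMap.adjoint (resolvent T ζ) F -
      ContinuousLinearMap.adjoint T (ContinuousLinearMap.adjoint (resolvent T ζ) F) = F := by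
  have h3 : resolvent T ζ * (algebraMap ℂ (E →L[ℂ] E) ζ - T) = 1 := Ring.inverse_mul_cancel _ hζ
  refine ext_inner_right ℂ fun v => ?_
  have h4 := congrArg (fun A : E →L[ℂ] E => A v) h3
  simp only [mul_apply_eq_comp, Algebra.algebraMap_eq_smul_one, sub_apply,
    smul_apply, one_apply_eq_self, map_sub, map_smul] at h4
  rw [inner_sub_left, inner_smul_left, conj_conj, ContinuousLinearMap.adjoint_inner_left T,
    ContinuousLinearMap.adjoint_inner_left (resolvent T ζ) v,
    ContinuousLinearMap.adjoint_inner_left (resolvent T ζ), ← inner_smul_right, ← inner_sub_right,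
    h4]

/-- The pointwise formula for the adjoint of `φ(T)`, `φ` a Möbius map. -/
theorem IsQuasiHomogeneous.exists_adjoint_holCalc_apply {n : ℕ} {lam : Fin n → {x : ℝ // 0 < x}}
    {m : Fin n → Fin n → ℂ} {T : HSum lam →L[ℂ] HSum lam} (hT : IsQuasiHomogeneous lam m T)
    (j : Fin n) :
    ∃ c : Fin n → ℕ → ℂ, c j 0 = 1 ∧ (∀ i < j, c i 0 = 0) ∧
      (∀ i : Fin n, (j : ℕ) = i + 1 → c i 1 = conj (m i j)) ∧
      ∀ (θ : ℝ) (a : UnitDisc) (r : ℝ), 1 < r → r * ‖(a : ℂ)‖ < 1 → ∀ (F : HSum lam) (w : UnitDisc),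
        (ContinuousLinearMap.adjoint (holCalc (mobius θ a) T r) F) j w =
          ∑ i ∈ Finset.univ.filter (· ≤ j), ∑ l ∈ Finset.range ((j : ℕ) - i + 1),
            c i l / l.factorial * (iteratedDeriv l (mobius (-θ) (star a)) w *
              iteratedDeriv ((j : ℕ) - i - l) (toFun (F i)) w) := by
  obtain ⟨c, h0, h1, h2, hc⟩ := exists_resolvent_coeff (fun i j => conj (m i j)) j
  refine ⟨c, h0, h1, h2, fun θ a r hr hra F w => ?_⟩
  have hr0 : 0 < r := zero_lt_one.trans hr
  have hnorm : ∀ ζ ∈ sphere (0 : ℂ) r, 1 < ‖ζ‖ := fun ζ hζ => by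
    rwa [mem_sphere_zero_iff_norm.1 hζ]
  -- Radius of a disc slightly larger than the contour on which the Möbius map is still holomorphic.
  have hR : (r + (1 - r * ‖(a : ℂ)‖)) * ‖(a : ℂ)‖ ≤ 1 := by
    nlinarith [a.norm_lt_one, norm_nonneg (a : ℂ)]
  have hrR : r < r + (1 - r * ‖(a : ℂ)‖) := by linarith
  have hd := differentiableOn_mobius_of_le θ a hR
  have hcont : ContinuousOn (mobius θ a) (sphere 0 r) := hd.continuousOn.mono fun ζ hζ => by
    rw [mem_ball_zero_iff, mem_sphere_zero_iff_norm.1 hζ]; exact hrR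
  have hwr : ‖conj (w : ℂ)‖ < r := by rw [RCLike.norm_conj]; exact w.norm_lt_one.trans hr
  have key : ∀ ζ ∈ sphere (0 : ℂ) r,
      inner ℂ F (resolvent T ζ (PiLp.single 2 j (kvec (lam j) w))) =
        ∑ i ∈ Finset.univ.filter (· ≤ j), ∑ l ∈ Finset.range ((j : ℕ) - i + 1),
          conj (c i l) * (ζ - conj (w : ℂ))⁻¹ ^ (l + 1) *
            conj (iteratedDeriv ((j : ℕ) - i - l) (toFun (F i)) w) := by
    intro ζ hζ
    have hu := hT.isUnit_sub (hnorm ζ hζ)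
    set G := ContinuousLinearMap.adjoint (resolvent T ζ) F with hG
    have hGF : conj ζ • G - ContinuousLinearMap.adjoint T G = F := adjoint_resolvent_apply hu F
    -- The adjoint resolvent applied to `F` solves the triangular system at `conj ζ`, so the
    -- universal coefficients apply.
    have hsol : IsTriangularSolution (fun i j => conj (m i j)) (conj ζ) (fun i => toFun (F i))
        (fun i => toFun (G i)) := by
      refine ⟨fun i => differentiableOn_toFun _, fun i => differentiableOn_toFun _,
        fun i z hz => ?_⟩
      have h5 := hT.adjoint_apply G i (UnitDisc.mk z (mem_ball_zero_iff.1 hz))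
      have h6 := toFun_coe (F i) (UnitDisc.mk z (mem_ball_zero_iff.1 hz))
      have h7 := toFun_coe (G i) (UnitDisc.mk z (mem_ball_zero_iff.1 hz))
      rw [UnitDisc.coe_mk] at h5 h6 h7
      have h8 := congrArg
        (fun X : HSum lam => X i (UnitDisc.mk z (mem_ball_zero_iff.1 hz))) hGF
      simp only [PiLp.sub_apply, PiLp.smul_apply, RKHS.coe_sub, RKHS.coe_smul, Pi.sub_apply,
        Pi.smul_apply, h5, smul_eq_mul] at h8
      rw [h6, h7, ← h8]
      ring
    have h8 := hc (conj ζ) (by rw [RCLike.norm_conj]; exact (hnorm ζ hζ).le) _ _ hsol w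
      (mem_ball_zero_iff.2 w.norm_lt_one)
    rw [← ContinuousLinearMap.adjoint_inner_left, ← hG, ← inner_conj_symm,
      HSum.inner_single_left, inner_kvec_left, ← toFun_coe, h8]
    simp only [resExp, map_sum, map_mul, map_pow, map_inv₀, map_sub, conj_conj]
  have hci : ∀ (b d : ℂ) (l : ℕ), CircleIntegrable
      (fun ζ => mobius θ a ζ * (b * (ζ - conj (w : ℂ))⁻¹ ^ (l + 1) * d)) 0 r := fun b d l =>
    ContinuousOn.circleIntegrable hr0.le (hcont.mul ((continuousOn_const.mul
      (((continuousOn_id.sub continuousOn_const).inv₀ fun ζ hζ h => by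
        have h9 : ζ = conj (w : ℂ) := sub_eq_zero.1 h
        rw [← h9, mem_sphere_zero_iff_norm.1 hζ] at hwr
        exact lt_irrefl _ hwr).pow _)).mul continuousOn_const))
  rw [← inner_kvec_left, ← HSum.inner_single_left, ContinuousLinearMap.adjoint_inner_right,
    ← inner_conj_symm, inner_holCalc_apply hr0.le hcont
      (fun ζ hζ => hT.isUnit_sub (hnorm ζ hζ)),
    circleIntegral.integral_congr hr0.le (fun ζ hζ => by rw [key ζ hζ])]
  simp only [Finset.mul_sum]
  rw [circleIntegral.integral_fun_sum fun i _ => CircleIntegrable.fun_sum _ fun l _ => hci _ _ _,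
    Finset.mul_sum, map_sum]
  refine Finset.sum_congr rfl fun i _ => ?_
  rw [circleIntegral.integral_fun_sum fun l _ => hci _ _ _, Finset.mul_sum, map_sum]
  refine Finset.sum_congr rfl fun l _ => ?_
  have e : (fun ζ => mobius θ a ζ * (conj (c i l) * (ζ - conj (w : ℂ))⁻¹ ^ (l + 1) *
      conj (iteratedDeriv ((j : ℕ) - i - l) (toFun (F i)) w))) =
      fun ζ => (conj (c i l) * conj (iteratedDeriv ((j : ℕ) - i - l) (toFun (F i)) w)) *
        (mobius θ a ζ * (ζ - conj (w : ℂ))⁻¹ ^ (l + 1)) := by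
    funext ζ; ring
  rw [e, circleIntegral.integral_const_mul, circleIntegral_mul_inv_sub_pow hr0 hrR hwr l hd,
    ← conj_iteratedDeriv_mobius]
  have hpi : (2 * Real.pi * I : ℂ) ≠ 0 := two_pi_I_ne_zero
  have e2 : (2 * Real.pi * I : ℂ)⁻¹ * (conj (c i l) *
      conj (iteratedDeriv ((j : ℕ) - i - l) (toFun (F i)) w) *
      (2 * Real.pi * I / l.factorial * iteratedDeriv l (mobius θ a) (conj (w : ℂ)))) =
      conj (c i l) / l.factorial * (iteratedDeriv l (mobius θ a) (conj (w : ℂ)) *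
      conj (iteratedDeriv ((j : ℕ) - i - l) (toFun (F i)) w)) := by
    field_simp
  rw [e2]
  simp

/-! ### Möbius boundedness -/

theorem lam_eq_add {n : ℕ} {lam : Fin n → {x : ℝ // 0 < x}} {Λ : ℝ}
    (hΛ : ∀ i j : Fin n, (j : ℕ) = (i : ℕ) + 1 → (lam j : ℝ) - (lam i : ℝ) = Λ) {i j : Fin n}
    (k : ℕ) (h : (j : ℕ) = i + k) : (lam j : ℝ) = lam i + k * Λ := by
  induction k generalizing j with
  | zero => rw [show j = i from Fin.ext h]; simp
  | succ k ih =>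
    have hk : (i : ℕ) + k < n := by omega
    have h1 := ih (j := ⟨i + k, hk⟩) rfl
    have h2 := hΛ ⟨i + k, hk⟩ j (by rw [h]; rfl)
    push_cast
    linarith

/-- The `k - p` derivatives of `F` raise the index by `2 (k - p)` and multiplication by the `p`-th
derivative of the Möbius map by `2 p`, together `2 k`. -/
theorem exists_uniform_bound_term (l l' : {x : ℝ // 0 < x}) {k p : ℕ} (hp : 1 ≤ p) (hpk : p ≤ k)
    (h : (l : ℝ) + 2 * k ≤ l') :
    ∃ B : ℝ, ∀ (θ : ℝ) (a : UnitDisc) (F : ℂ → ℂ) (C : ℝ), InH l F C →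
      InH l' (fun z => iteratedDeriv p (mobius θ a) z * iteratedDeriv (k - p) F z) (B * C) := by
  obtain ⟨q, rfl⟩ := Nat.exists_eq_add_of_le' hp
  obtain ⟨B, hB⟩ := InH.exists_bound_iteratedDeriv l (k - (q + 1))
  have hl := l.2
  let s : {x : ℝ // 0 < x} := ⟨l + 2 * (k - (q + 1) : ℕ), by positivity⟩
  obtain ⟨B', hB'⟩ := InH.exists_bound_mul_iteratedDeriv_mobius s q
  refine ⟨B' * B, fun θ a F C hF => ?_⟩
  have h1 := hB' ⟨s + 2 * (q + 1), by have := s.2; positivity⟩ rfl θ a _ _ (hB s rfl F C hF)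
  rw [mul_assoc]
  refine h1.inclusion (le_of_eq_of_le ?_ h)
  simp only [s]
  rw [Nat.cast_sub hpk]
  push_cast
  ring

theorem IsQuasiHomogeneous.exists_bound_component {n : ℕ} {lam : Fin n → {x : ℝ // 0 < x}}
    {m : Fin n → Fin n → ℂ} {T : HSum lam →L[ℂ] HSum lam} (hT : IsQuasiHomogeneous lam m T)
    {Λ : ℝ} (hΛ : ∀ i j : Fin n, (j : ℕ) = (i : ℕ) + 1 → (lam j : ℝ) - (lam i : ℝ) = Λ)
    (h2 : 2 ≤ Λ) (j : Fin n) :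
    ∃ B : ℝ, ∀ (θ : ℝ) (a : UnitDisc) (r : ℝ), 1 < r → r * ‖(a : ℂ)‖ < 1 → ∀ F : HSum lam,
      ‖(ContinuousLinearMap.adjoint (holCalc (mobius θ a) T r) F) j‖ ≤ B * ‖F‖ := by
  obtain ⟨c, -, hc0, -, hc⟩ := hT.exists_adjoint_holCalc_apply j
  have hterm : ∀ (i : Fin n) (l : ℕ), ∃ B : ℝ, i ≤ j → l ∈ Finset.range ((j : ℕ) - i + 1) →
      ∀ (θ : ℝ) (a : UnitDisc) (F : HSum lam), InH (lam j)
        (fun w => c i l / l.factorial * (iteratedDeriv l (mobius (-θ) (star a)) w *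
              iteratedDeriv ((j : ℕ) - i - l) (toFun (F i)) w)) (B * ‖F i‖) := by
    intro i l
    by_cases hij : i ≤ j
    swap
    · exact ⟨0, fun h => absurd h hij⟩
    by_cases hl : l ∈ Finset.range ((j : ℕ) - i + 1)
    swap
    · exact ⟨0, fun _ h => absurd h hl⟩
    have hl' : l ≤ (j : ℕ) - i := Nat.lt_succ_iff.1 (Finset.mem_range.1 hl)
    rcases Nat.eq_zero_or_pos l with rfl | hpos
    · rcases hij.lt_or_eq with hlt | rfl
      · refine ⟨0, fun _ _ θ a F => ?_⟩
        simp only [hc0 i hlt, zero_div, zero_mul]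
        exact InH.zero _
      · refine ⟨‖c i 0 / (Nat.factorial 0 : ℕ)‖ * ‖ContinuousLinearMap.adjoint (block T i i)‖,
          fun _ _ θ a F => ?_⟩
        simp only [Nat.sub_self, iteratedDeriv_zero]
        rw [mul_assoc]
        exact ((inH_toFun (F i)).mul_mobius (hT.diag i) _ _).const_mul _
    · have hle := Fin.le_def.1 hij
      -- The only use of `Λ ≥ 2`: there is room for `j - i` derivatives.
      have hlam : (lam i : ℝ) + 2 * ((j : ℕ) - i : ℕ) ≤ lam j := by
        rw [lam_eq_add hΛ ((j : ℕ) - i) (by omega : (j : ℕ) = i + ((j : ℕ) - i))]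
        have : (0 : ℝ) ≤ ((j : ℕ) - i : ℕ) := by positivity
        nlinarith
      obtain ⟨B, hB⟩ := exists_uniform_bound_term (lam i) (lam j) hpos hl' hlam
      refine ⟨‖c i l / l.factorial‖ * B, fun _ _ θ a F => ?_⟩
      rw [mul_assoc]
      exact (hB _ _ _ _ (inH_toFun (F i))).const_mul _
  choose B hB using hterm
  refine ⟨∑ i ∈ Finset.univ.filter (· ≤ j), ∑ l ∈ Finset.range ((j : ℕ) - i + 1), |B i l|,
    fun θ a r hr hra F => ?_⟩
  obtain ⟨g, hg, hgC⟩ := InH.sum (Finset.univ.filter (· ≤ j)) fun i hi =>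
    InH.sum (Finset.range ((j : ℕ) - i + 1)) fun l hl =>
      hB i l (Finset.mem_filter.1 hi).2 hl θ a F
  have : (ContinuousLinearMap.adjoint (holCalc (mobius θ a) T r) F) j = g :=
    RKHS.ext fun w => by rw [hc θ a r hr hra, hg]
  rw [this]
  refine hgC.trans ?_
  rw [Finset.sum_mul]
  refine Finset.sum_le_sum fun i _ => ?_
  rw [Finset.sum_mul]
  refine Finset.sum_le_sum fun l _ => ?_
  have := PiLp.norm_apply_le F i
  exact mul_le_mul (le_abs_self _) this (norm_nonneg _) (abs_nonneg _)

theorem HSum.norm_le_sum {n : ℕ} {lam : Fin n → {x : ℝ // 0 < x}} (F : HSum lam) :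
    ‖F‖ ≤ ∑ j, ‖F j‖ := by
  have h : F = ∑ j, (PiLp.single 2 j (F j) : HSum lam) := by
    refine ext_inner_right ℂ fun G => ?_
    rw [sum_inner, PiLp.inner_apply]
    simp only [HSum.inner_single_left]
  calc ‖F‖ = ‖∑ j, (PiLp.single 2 j (F j) : HSum lam)‖ := by rw [← h]
    _ ≤ ∑ j, ‖(PiLp.single 2 j (F j) : HSum lam)‖ := norm_sum_le _ _
    _ = ∑ j, ‖F j‖ := by simp only [PiLp.norm_single]

theorem IsQuasiHomogeneous.mobiusBounded {n : ℕ} {lam : Fin n → {x : ℝ // 0 < x}}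
    {m : Fin n → Fin n → ℂ} {T : HSum lam →L[ℂ] HSum lam} (hT : IsQuasiHomogeneous lam m T)
    {Λ : ℝ} (hΛ : ∀ i j : Fin n, (j : ℕ) = (i : ℕ) + 1 → (lam j : ℝ) - (lam i : ℝ) = Λ)
    (h2 : 2 ≤ Λ) : MobiusBounded T := by
  refine ⟨hT.spectrum_subset, ?_⟩
  choose B hB using hT.exists_bound_component hΛ h2
  refine ⟨∑ j, |B j|, fun θ a r hr hra => ?_⟩
  rw [← ContinuousLinearMap.adjoint.norm_map]
  refine ContinuousLinearMap.opNorm_le_bound _ (by positivity) fun F => ?_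
  refine (HSum.norm_le_sum _).trans ?_
  rw [Finset.sum_mul]
  refine Finset.sum_le_sum fun j _ => (hB j θ a r hr hra F).trans ?_
  have := le_abs_self (B j)
  gcongr

/-! ### Necessity of `Λ ≥ 2`: testing on kernel functions. -/

theorem norm_kvec_sq (l : {x : ℝ // 0 < x}) (a : UnitDisc) :
    ‖kvec l a‖ ^ 2 = (1 - ‖(a : ℂ)‖ ^ 2) ^ (-(l : ℝ)) := by
  have h : ((‖kvec l a‖ ^ 2 : ℝ) : ℂ) = ((1 - ‖(a : ℂ)‖ ^ 2) ^ (-(l : ℝ)) : ℝ) := by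
    rw [ofReal_cpow (one_sub_norm_sq_pos a).le]
    push_cast
    refine (inner_self_eq_norm_sq_to_K (𝕜 := ℂ) (kvec l a)).symm.trans ?_
    rw [inner_kvec_left, kvec_apply, kerExpr, mul_conj']
  exact_mod_cast h

theorem IsQuasiHomogeneous.two_le_of_mobiusBounded {n : ℕ} {lam : Fin n → {x : ℝ // 0 < x}}
    {m : Fin n → Fin n → ℂ} {T : HSum lam →L[ℂ] HSum lam} (hT : IsQuasiHomogeneous lam m T)
    {i j : Fin n} (hij : (j : ℕ) = i + 1) (hm : m i j ≠ 0) (hb : MobiusBounded T) :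
    2 ≤ (lam j : ℝ) - lam i := by
  obtain ⟨-, C, hC⟩ := hb
  obtain ⟨c, -, hc0, hc1, hc⟩ := hT.exists_adjoint_holCalc_apply j
  have hlt : i < j := Fin.lt_def.2 (by omega)
  have key : ∀ a : UnitDisc,
      ‖m i j‖ ≤ C * (1 - ‖(a : ℂ)‖ ^ 2) ^ (1 - ((lam j : ℝ) - lam i) / 2) := by
    intro a
    have hpos := one_sub_norm_sq_pos a
    have hex : ∃ r : ℝ, 1 < r ∧ r * ‖((star a : UnitDisc) : ℂ)‖ < 1 := by
      have h1 := (star a).norm_lt_one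
      have h0 := norm_nonneg ((star a : UnitDisc) : ℂ)
      refine ⟨1 + (1 - ‖((star a : UnitDisc) : ℂ)‖), by linarith, by nlinarith⟩
    obtain ⟨r, hr, hra⟩ := hex
    -- Only column `i` contributes to component `j` of the image, and there only the term with the
    -- first derivative of the Möbius map survives. The parameter `star a` is chosen so that the
    -- conjugated map vanishes at `a`, where its derivative is `(1 - |a|²)⁻¹`.
    let F : HSum lam := PiLp.single 2 i (kvec (lam i) a)
    have hFi : F i = kvec (lam i) a := PiLp.single_eq_same (β := fun i => HSpace (lam i)) 2 i _
    have hF0 : ∀ k, k ≠ i → F k = 0 := fun k hk =>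
      PiLp.single_eq_of_ne (β := fun i => HSpace (lam i)) 2 hk _
    have hval := hc 0 (star a) r hr hra F a
    rw [Finset.sum_eq_single i, show (j : ℕ) - i + 1 = 2 by omega, Finset.sum_range_succ,
      Finset.sum_range_one, hc0 i hlt, hc1 i hij, star_star, show (j : ℕ) - i - 1 = 0 by omega,
      hFi] at hval
    rotate_left
    · intro k _ hk
      simp [hF0 k hk, toFun_zero]
    · simp [hlt.le]
    simp only [iteratedDeriv_zero, iteratedDeriv_one, toFun_kvec] at hval
    have hder : deriv (mobius (-0) a) a = ((1 - ‖(a : ℂ)‖ ^ 2 : ℝ) : ℂ)⁻¹ := by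
      have hne : ((1 - ‖(a : ℂ)‖ ^ 2 : ℝ) : ℂ) ≠ 0 := ofReal_ne_zero.2 hpos.ne'
      have h3 : 1 - conj (a : ℂ) * a = ((1 - ‖(a : ℂ)‖ ^ 2 : ℝ) : ℂ) := by
        rw [conj_mul']; push_cast; ring
      have h4 : mobius (-0) a = mobius0 a := by funext z; simp [mobius_eq]
      rw [h4, (hasDerivAt_mobius0 a (one_sub_conj_mul_ne_zero a a.norm_lt_one)).deriv, h3]
      field_simp
    have hker : kerExpr (lam i) a a = ((‖kvec (lam i) a‖ ^ 2 : ℝ) : ℂ) := by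
      rw [norm_kvec_sq, ofReal_cpow hpos.le, kerExpr, mul_conj']
      push_cast
      rfl
    have hnorm : ‖m i j‖ * ((1 - ‖(a : ℂ)‖ ^ 2)⁻¹ * ‖kvec (lam i) a‖ ^ 2) ≤
        ‖kvec (lam j) a‖ * (C * ‖kvec (lam i) a‖) := by
      have h5 : ‖(ContinuousLinearMap.adjoint (holCalc (mobius 0 (star a)) T r) F) j a‖ =
          ‖m i j‖ * ((1 - ‖(a : ℂ)‖ ^ 2)⁻¹ * ‖kvec (lam i) a‖ ^ 2) := by
        rw [hval, hder, hker]
        simp only [Nat.factorial_one, Nat.cast_one, div_one, zero_div, zero_mul, zero_add, norm_mul,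
          RCLike.norm_conj, norm_inv, Complex.norm_real, Real.norm_of_nonneg hpos.le,
          Real.norm_of_nonneg (sq_nonneg _)]
      rw [← h5, ← toFun_coe]
      refine (norm_apply_le_of_inH (inH_toFun _) a).trans ?_
      refine mul_le_mul_of_nonneg_left ((PiLp.norm_apply_le _ j).trans ?_) (norm_nonneg _)
      refine (ContinuousLinearMap.le_opNorm _ _).trans ?_
      rw [ContinuousLinearMap.adjoint.norm_map, PiLp.norm_single]
      exact mul_le_mul_of_nonneg_right (hC 0 (star a) r hr hra) (norm_nonneg _)
    set t := 1 - ‖(a : ℂ)‖ ^ 2 with ht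
    have hk : ∀ l : {x : ℝ // 0 < x}, ‖kvec l a‖ = t ^ (-(l : ℝ) / 2) := by
      intro l
      rw [← Real.sqrt_sq (norm_nonneg (kvec l a)), norm_kvec_sq, Real.sqrt_eq_rpow,
        ← Real.rpow_mul hpos.le]
      congr 1
      ring
    rw [hk, hk] at hnorm
    -- Both sides of `hnorm` are multiplied by `t ^ (1 + lam i)`, which isolates `‖m i j‖`.
    have e : C * t ^ (1 - ((lam j : ℝ) - lam i) / 2) =
        t ^ (-(lam j : ℝ) / 2) * (C * t ^ (-(lam i : ℝ) / 2)) * (t * t ^ (lam i : ℝ)) := by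
      have : t * t ^ (lam i : ℝ) = t ^ (1 + (lam i : ℝ)) := by
        rw [Real.rpow_add hpos, Real.rpow_one]
      rw [this, mul_left_comm, mul_assoc, ← Real.rpow_add hpos, ← Real.rpow_add hpos]
      congr 2
      ring
    have e2 : ‖m i j‖ = ‖m i j‖ * (t⁻¹ * (t ^ (-(lam i : ℝ) / 2)) ^ 2) * (t * t ^ (lam i : ℝ)) := by
      rw [← Real.rpow_natCast, ← Real.rpow_mul hpos.le,
        show -(lam i : ℝ) / 2 * (2 : ℕ) = -(lam i : ℝ) by push_cast; ring, Real.rpow_neg hpos.le]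
      have := (Real.rpow_pos_of_pos hpos (lam i : ℝ)).ne'
      field_simp
    rw [e, e2]
    exact mul_le_mul_of_nonneg_right hnorm (by positivity)
  by_contra hlt2
  rw [not_le] at hlt2
  have hs : 0 < 1 - ((lam j : ℝ) - lam i) / 2 := by linarith
  have hlim : Filter.Tendsto (fun t : ℝ => C * t ^ (1 - ((lam j : ℝ) - lam i) / 2))
      (nhdsWithin 0 (Set.Ioi 0)) (nhds 0) := by
    have := ((Real.continuousAt_rpow_const 0 _ (Or.inr hs.le)).tendsto.mono_left
      (nhdsWithin_le_nhds (s := Set.Ioi 0))).const_mul C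
    rwa [Real.zero_rpow hs.ne', mul_zero] at this
  have hle : ‖m i j‖ ≤ 0 := by
    refine ge_of_tendsto hlim ?_
    filter_upwards [Ioo_mem_nhdsGT (zero_lt_one (α := ℝ))] with t ht
    have h1t : 0 ≤ 1 - t := by linarith [ht.2]
    have hnt : ‖((√(1 - t) : ℝ) : ℂ)‖ = √(1 - t) := by
      rw [Complex.norm_real, Real.norm_of_nonneg (Real.sqrt_nonneg _)]
    -- The point with `1 - |a|² = t`; as `t → 0` the positive exponent forces `m i j = 0`.
    have h := key (UnitDisc.mk (√(1 - t) : ℝ) (by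
      rw [hnt, Real.sqrt_lt' one_pos]; linarith [ht.1]))
    rw [UnitDisc.coe_mk, hnt, Real.sq_sqrt h1t, sub_sub_cancel] at h
    exact h
  exact hm (norm_le_zero_iff.1 hle)

end

end QuasiHom

theorem mainTheorem10 (n : ℕ) (hn : 1 ≤ n) (lam : Fin n → {x : ℝ // 0 < x}) (hmono : Monotone lam)
    (Λ : ℝ) (hΛ : ∀ i j : Fin n, (j : ℕ) = (i : ℕ) + 1 → (lam j : ℝ) - (lam i : ℝ) = Λ)
    (m : Fin n → Fin n → ℂ) (T : QuasiHom.HSum lam →L[ℂ] QuasiHom.HSum lam)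
    (hT : QuasiHom.IsQuasiHomogeneous lam m T) :
    (2 ≤ Λ → QuasiHom.MobiusBounded T) ∧
      ((∃ i j : Fin n, (j : ℕ) = (i : ℕ) + 1 ∧ m i j ≠ 0) →
        (QuasiHom.MobiusBounded T ↔ 2 ≤ Λ)) := by
  refine ⟨hT.mobiusBounded hΛ, ?_⟩
  rintro ⟨i, j, hij, hm⟩
  refine ⟨fun hb => ?_, hT.mobiusBounded hΛ⟩
  rw [← hΛ i j hij]
  exact hT.two_le_of_mobiusBounded hij hm hb
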